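/- **Setting.** Consider a linear time-invariant plant $x_{t+1}=Ax_t+Bu_t+w_t$, $y_t=Cx_t+v_t$ ($x_t\in\mathbb R^n$, $u_t\in\mathbb R^m$, $y_t\in\mathbb R^p$) with a Kalman filter in steady state: $W=\mathrm{Cov}(w_t)$, $R=\mathrm{Cov}(v_t)$, the prediction error covariance $\Sigma\succeq 0$ satisfies $\Sigma=A(\Sigma-KC\Sigma)A^T+W$, where $Q=C\Sigma C^T+R\succ 0$ and $K=\Sigma C^TQ^{-1}$, and $$\hat x_{t+1}=A\hat x_t+Bu_t+K z_{t+1},\qquad z_{t+1}=y_{t+1}-C(A\hat x_t+Bu_t).$$ The system starts operating at some time $-N\le 0$ from an initial prediction $\bar x$, i.e. $z_{-N}=y_{-N}-C\bar x$ and $\hat x_{-N}=\bar x+Kz_{-N}$; the initial prediction error $x_{-N}-\bar x$ and the noises $w_t,v_t$ are independent centred Gaussian vectors with covariances $\Sigma$, $W$, $R$. The inputs $u_t$ are arbitrary (and may depend on the attack). An attack is a sequence $a_1,a_2,\dots\in\mathbb R^p$ of vectors supported on a set $\mathcal K$ of compromised sensors. At times $k\ge 1$ it changes the measurements to $y_k^a=Cx_k^a+v_k+a_k$;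 there is no attack at times $\le 0$. The resulting estimation error $x_k^a-\hat x_k^a$, residue and detection function are denoted $e_k^a,z_k^a,g_k^a$. The detector raises an alarm at time $k\ge1$ if $g_k>h$, where $$g_k=\sum_{i=k-\mathcal T_k+1}^{k}c_{i-k+\mathcal T_k}\,z_i^TQ^{-1}z_i ,$$ with weights $c_j\ge 0$, $c_{\mathcal T_k}>0$, and a window length $\mathcal T_k\ge 1$ such that all residues used exist (this includes a constant window and $\mathcal T_k=k$). Let $\beta_k=P(g_k>h)$ and $\beta_k^a=P(g_k^a>h)$. For $\varepsilon>0$ let $\mathcal A_k$ be the set of attacks with $\beta^a_{k'}\le\beta_{k'}+\varepsilon$ for all $1\le k'\le k$. For a fixed $\gamma\ge0$ let $$\mathcal R_k=\{e\in\mathbb R^n:\ ee^T\preccurlyeq E[e_k^a]E[e_k^a]^T+\gamma\,\mathrm{Cov}(e_k^a)\ \text{for some } a\in\mathcal A_k\}.$$ For $\alpha>0$ let $\hat{\mathcal R}^\alpha_0=\{0\}$ and, for $k\ge1$, let $\hat{\mathcal R}^\alpha_k$ be the set of all $$\Delta e_k=(A-KCA)\Delta e_{k-1}-Ka_k$$ with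 $\Delta e_{k-1}\in\hat{\mathcal R}^\alpha_{k-1}$ and $a_k\in\mathbb R^p$ supported on $\mathcal K$ such that $\Delta z_k=CA\,\Delta e_{k-1}+a_k$ satisfies $\|\Delta z_k\|_2\le\alpha$. **Theorem.** Let $\varepsilon>0$, $\gamma\ge 0$ and $\alpha>0$. 1. For every $k\ge0$ such that $\varepsilon<1-\beta_{k'}$ for all $1\le k'\le k$, the set $\mathcal R_k$ is bounded if and only if $\hat{\mathcal R}^\alpha_k$ is bounded. 2. If the window length is constant and $\varepsilon<1-\beta_k$ for all $k\ge 1$, then the global reachable region $\mathcal R=\bigcup_{k\ge1}\mathcal R_k$ is bounded if and only if $\hat{\mathcal R}^\alpha=\bigcup_{k\ge0}\hat{\mathcal R}^\alpha_k$ is bounded. -/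

import Mathlib

open MeasureTheory ProbabilityTheory Matrix

namespace AttackedKalman

noncomputable section

/-- Real `d`-dimensional vectors with the Euclidean norm. -/
abbrev Vec (d : ℕ) := EuclideanSpace ℝ (Fin d)

/-- Matrix times vector. -/
abbrev act {r s : ℕ} (M : Matrix (Fin r) (Fin s) ℝ) (x : Vec s) : Vec r :=
  Matrix.toEuclideanLin M x

/-- The quadratic form `xᵀ M x`. -/
def quad {r : ℕ} (M : Matrix (Fin r) (Fin r) ℝ) (x : Vec r) : ℝ :=
  x.ofLp ⬝ᵥ (M *ᵥ x.ofLp)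

/-- Data of a linear time-invariant plant `x⁺ = A x + B u + w`, `y = C x + v` with process noise
covariance `W`, sensor noise covariance `R`, and (prediction) error covariance `Sig` of the
Kalman filter. -/
structure Plant (n m p : ℕ) where
  A : Matrix (Fin n) (Fin n) ℝ
  B : Matrix (Fin n) (Fin m) ℝ
  C : Matrix (Fin p) (Fin n) ℝ
  W : Matrix (Fin n) (Fin n) ℝ
  R : Matrix (Fin p) (Fin p) ℝ
  Sig : Matrix (Fin n) (Fin n) ℝ

variable {n m p : ℕ}

/-- Residue covariance `Q = C Σ Cᵀ + R`. -/
def Plant.Q (S : Plant n m p) : Matrix (Fin p) (Fin p) ℝ :=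
  S.C * S.Sig * S.Cᵀ + S.R

/-- Kalman gain `K = Σ Cᵀ (C Σ Cᵀ + R)⁻¹`. -/
def Plant.K (S : Plant n m p) : Matrix (Fin n) (Fin p) ℝ :=
  S.Sig * S.Cᵀ * S.Q⁻¹

/-- `W`, `R`, `Σ` are covariance matrices, the residue covariance is nondegenerate, and `Σ` is a
steady state of the Kalman filter covariance recursion (discrete algebraic Riccati equation). -/
structure Plant.IsSteady (S : Plant n m p) : Prop where
  posSemidef_W : S.W.PosSemidef
  posSemidef_R : S.R.PosSemidef
  posSemidef_Sig : S.Sig.PosSemidef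
  posDef_Q : S.Q.PosDef
  riccati : S.Sig = S.A * (S.Sig - S.K * S.C * S.Sig) * S.Aᵀ + S.W

/-- The exogenous signals, indexed by the number of steps since the plant started operating:
initial state `x0`, initial state prediction `xbar0` of the filter, process noise `w`, sensor
noise `v`, and the control input. The input may depend in an arbitrary way on the signal that is
injected into the measurements (through whatever controller is used), on time and on the outcome. -/
structure Signals (n m p : ℕ) (Ω : Type*) where
  x0 : Ω → Vec n
  xbar0 : Ω → Vec n
  w : ℕ → Ω → Vec n
  v : ℕ → Ω → Vec p
  u : (ℕ → Vec p) → ℕ → Ω → Vec m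

variable {Ω : Type*} [MeasurableSpace Ω]

/-- The initial prediction error and the noises are independent centred Gaussian vectors, the
prediction error having its steady state covariance `Σ`. (A deterministic `xbar0` is the case of a
Gaussian `x0` with mean `xbar0`.) -/
structure Signals.IsGaussian (F : Signals n m p Ω) (S : Plant n m p) (μ : Measure Ω) : Prop where
  law_init : HasLaw (fun ω => F.x0 ω - F.xbar0 ω) (multivariateGaussian 0 S.Sig) μ
  law_w : ∀ t, HasLaw (F.w t) (multivariateGaussian 0 S.W) μ
  law_v : ∀ t, HasLaw (F.v t) (multivariateGaussian 0 S.R) μ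
  indep_w : iIndepFun F.w μ
  indep_v : iIndepFun F.v μ
  indep_wv : IndepFun (fun ω t => F.w t ω) (fun ω t => F.v t ω) μ
  indep_init : IndepFun (fun ω => F.x0 ω - F.xbar0 ω)
    (fun ω => (fun t => F.w t ω, fun t => F.v t ω)) μ

/-- Plant state and Kalman estimate `(x_t, x̂_t)` after `t` steps of operation, when the signal `s`
is added to the measurements, i.e. `y_t = C x_t + v_t + s_t`. -/
def loop (S : Plant n m p) (F : Signals n m p Ω) (s : ℕ → Vec p) (ω : Ω) : ℕ → Vec n × Vec n
  | 0 => (F.x0 ω,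
      F.xbar0 ω + act S.K (act S.C (F.x0 ω) + F.v 0 ω + s 0 - act S.C (F.xbar0 ω)))
  | t + 1 =>
      let x' := act S.A (loop S F s ω t).1 + act S.B (F.u s t ω) + F.w t ω
      let pred := act S.A (loop S F s ω t).2 + act S.B (F.u s t ω)
      (x', pred + act S.K (act S.C x' + F.v (t + 1) ω + s (t + 1) - act S.C pred))

/-- Measurement `y_t = C x_t + v_t + s_t` that reaches the estimator. -/
def output (S : Plant n m p) (F : Signals n m p Ω) (s : ℕ → Vec p) (t : ℕ) (ω : Ω) : Vec p :=
  act S.C (loop S F s ω t).1 + F.v t ω + s t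

/-- Residue: the measurement minus the predicted measurement. -/
def residue (S : Plant n m p) (F : Signals n m p Ω) (s : ℕ → Vec p) : ℕ → Ω → Vec p
  | 0, ω => output S F s 0 ω - act S.C (F.xbar0 ω)
  | t + 1, ω => output S F s (t + 1) ω -
      act S.C (act S.A (loop S F s ω t).2 + act S.B (F.u s t ω))

/-- Estimation error `x_t - x̂_t`. -/
def estError (S : Plant n m p) (F : Signals n m p Ω) (s : ℕ → Vec p) (t : ℕ) (ω : Ω) : Vec n :=
  (loop S F s ω t).1 - (loop S F s ω t).2

/-- The signal seen by the loop when the plant has operated `N` steps before time `0` of the attack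
clock: nothing is injected up to time `0`, and `a_k` is injected at time `k ≥ 1`, which is
step `N + k` of the operation. -/
def injected (N : ℕ) (a : ℕ → Vec p) (t : ℕ) : Vec p :=
  if N < t then a (t - N) else 0

/-- A windowed detector: window length `T k` at time `k`, weights `c 1, c 2, …`, threshold `h`. -/
structure Detector where
  T : ℕ → ℕ
  c : ℕ → ℝ
  h : ℝ

/-- The weights are nonnegative, the weight of the current residue is positive, and the window at
each time `k ≥ 1` is nonempty and only uses residues that exist, when the plant has operated `N`
steps before time `0`. Constant windows with `T ≤ N + 2` and `T k = k` are both covered. -/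
structure Detector.IsAdmissible (D : Detector) (N : ℕ) : Prop where
  nonneg : ∀ j, 1 ≤ j → 0 ≤ D.c j
  pos : ∀ k, 1 ≤ k → 0 < D.c (D.T k)
  one_le : ∀ k, 1 ≤ k → 1 ≤ D.T k
  le : ∀ k, 1 ≤ k → D.T k ≤ N + k + 1

/-- Detection function `g_k = ∑_{i=k-T+1}^{k} c_{i-k+T} z_iᵀ Q⁻¹ z_i`, written with
`j = i - k + T`, under the attack `a`. -/
def detection (S : Plant n m p) (F : Signals n m p Ω) (N : ℕ) (D : Detector)
    (a : ℕ → Vec p) (k : ℕ) (ω : Ω) : ℝ :=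
  ∑ j ∈ Finset.Icc 1 (D.T k),
    D.c j * quad S.Q⁻¹ (residue S F (injected N a) (N + k + j - D.T k) ω)

/-- Alarm probability at time `k` under the attack `a`; `a = 0` is the system without attack. -/
def alarm (S : Plant n m p) (F : Signals n m p Ω) (μ : Measure Ω) (N : ℕ) (D : Detector)
    (a : ℕ → Vec p) (k : ℕ) : ℝ :=
  μ.real {ω | D.h < detection S F N D a k ω}

/-- Attacks supported on the compromised sensors `Ks` that are stealthy up to time `k`. An attack is
written as an infinite sequence `a_1, a_2, …`; only `a_1, …, a_k` are constrained by stealthiness,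
and only they influence the system up to time `k`. -/
def stealthy (S : Plant n m p) (F : Signals n m p Ω) (μ : Measure Ω) (N : ℕ) (D : Detector)
    (Ks : Set (Fin p)) (ε : ℝ) (k : ℕ) : Set (ℕ → Vec p) :=
  {a | (∀ j, ∀ i, i ∉ Ks → a j i = 0) ∧
    ∀ k', 1 ≤ k' → k' ≤ k → alarm S F μ N D a k' ≤ alarm S F μ N D 0 k' + ε}

/-- Covariance matrix of a random vector. -/
def covMat {d : ℕ} (μ : Measure Ω) (X : Ω → Vec d) : Matrix (Fin d) (Fin d) ℝ :=
  Matrix.of fun i j => covariance (fun ω => X ω i) (fun ω => X ω j) μ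

/-- The `k`-reachable region: all `e` with `e eᵀ ≼ E[e_k^a] E[e_k^a]ᵀ + γ Cov(e_k^a)` for some attack
that is stealthy up to time `k`. -/
def reach (S : Plant n m p) (F : Signals n m p Ω) (μ : Measure Ω) (N : ℕ) (D : Detector)
    (Ks : Set (Fin p)) (ε γ : ℝ) (k : ℕ) : Set (Vec n) :=
  {e | ∃ a ∈ stealthy S F μ N D Ks ε k,
    let X : Ω → Vec n := estError S F (injected N a) (N + k)
    let E : Vec n := ∫ ω, X ω ∂μ
    (vecMulVec E.ofLp E.ofLp + γ • covMat μ X - vecMulVec e.ofLp e.ofLp).PosSemidef}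

/-- The set `R̂_k^α`: `R̂_0^α = {0}`, and `R̂_{k+1}^α` consists of the
`Δe_{k+1} = (A - KCA) Δe_k - K a_{k+1}` with `Δe_k ∈ R̂_k^α` and `a_{k+1}` supported on the
compromised sensors such that `Δz_{k+1} = CA Δe_k + a_{k+1}` has Euclidean norm at most `α`. -/
def reachHat (S : Plant n m p) (Ks : Set (Fin p)) (α : ℝ) : ℕ → Set (Vec n)
  | 0 => {0}
  | k + 1 => {e' | ∃ e ∈ reachHat S Ks α k, ∃ a : Vec p, (∀ i, i ∉ Ks → a i = 0) ∧
      e' = act (S.A - S.K * S.C * S.A) e - act S.K a ∧ ‖act (S.C * S.A) e + a‖ ≤ α}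

end

end AttackedKalman

open MeasureTheory ProbabilityTheory Matrix

namespace AttackedKalman

noncomputable section

open Filter Topology

section

variable {Ω : Type*} [MeasurableSpace Ω]

/-! ### Linear images and sums of centred Gaussian vectors -/

/-! The loop is linear and the input enters plant and filter alike, so it cancels from the errors.
The estimation error and residue under attack are therefore the attack-free ones plus deterministic
responses `attackErr` and `attackRes` (`estError_eq`, `residue_eq`). In steady state the attack-free
process is stationary (`measurePreserving_advance`). Consequently the error covariance is the same
for all attacks and times, the mean is a constant plus `attackErr`, and the alarm probability is a
function `windowAlarm` of the window length and of the residue increments in the window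
(`alarm_eq`). Boundedness of the reachable region thus means boundedness of `attackErr` over
stealthy attacks.

Stealthiness is sandwiched between two norm bounds on the increments. Small increments are stealthy,
because `windowAlarm` is continuous at `0`: the detection function is a quadratic function of a
Gaussian vector with null level sets (`measure_windowStat_eq_zero`, `eventually_windowAlarm_le`).
Conversely, an alarm probability below `1` bounds the last increment, because by Markov's inequality
the noise cannot compensate a large one (`eventually_norm_last_le`).

Hence the responses of stealthy attacks contain the deterministic set for some bound `δ > 0` and lie
in the one for some bound `M`. By linearity (`smul_mem_reachHat`) these sets are dilations of each
other, so all are bounded or none is. The constants `δ` and `M` depend on time only through the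
window length, which gives uniformity for a constant window. -/

@[fun_prop]
theorem continuous_act {r s : ℕ} (M : Matrix (Fin r) (Fin s) ℝ) : Continuous (act M) :=
  (Matrix.toEuclideanLin M).continuous_of_finiteDimensional

@[fun_prop]
theorem measurable_act {r s : ℕ} (M : Matrix (Fin r) (Fin s) ℝ) : Measurable (act M) :=
  (continuous_act M).measurable

theorem act_act {r s t : ℕ} (M : Matrix (Fin r) (Fin s) ℝ) (N : Matrix (Fin s) (Fin t) ℝ)
    (x : Vec t) : act M (act N x) = act (M * N) x := by
  ext i; simp [Matrix.toLpLin_apply, Matrix.mulVec_mulVec]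

theorem act_sub_left {r s : ℕ} (M N : Matrix (Fin r) (Fin s) ℝ) (x : Vec s) :
    act (M - N) x = act M x - act N x := by
  simp [act]

theorem inner_act {r s : ℕ} (M : Matrix (Fin r) (Fin s) ℝ) (x : Vec s) (y : Vec r) :
    inner ℝ (act M x) y = inner ℝ x (act Mᵀ y) := by
  simp [EuclideanSpace.inner_eq_star_dotProduct, Matrix.toLpLin_apply, Matrix.dotProduct_mulVec,
    Matrix.vecMul_transpose, dotProduct_comm]

/-- Characteristic functions are compared because the covariances may be singular, so that densities
need not exist. -/
theorem hasLaw_act {μ : Measure Ω} {r s : ℕ} {S : Matrix (Fin s) (Fin s) ℝ} (hS : S.PosSemidef)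
    {X : Ω → Vec s} (hX : HasLaw X (multivariateGaussian 0 S) μ) (M : Matrix (Fin r) (Fin s) ℝ) :
    HasLaw (fun ω => act M (X ω)) (multivariateGaussian 0 (M * S * Mᵀ)) μ := by
  have hMS : (M * S * Mᵀ).PosSemidef := by
    simpa using hS.mul_mul_conjTranspose_same M
  have key : HasLaw (act M) (multivariateGaussian 0 (M * S * Mᵀ)) (multivariateGaussian 0 S) := by
    refine ⟨(measurable_act M).aemeasurable, ?_⟩
    have : IsProbabilityMeasure ((multivariateGaussian 0 S).map (act M)) :=
      Measure.isProbabilityMeasure_map (measurable_act M).aemeasurable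
    refine Measure.ext_of_charFun ?_
    ext t
    rw [charFun_apply, integral_map (measurable_act M).aemeasurable (by fun_prop),
      charFun_multivariateGaussian hMS]
    simp_rw [inner_act]
    rw [← charFun_apply, charFun_multivariateGaussian hS]
    simp [Matrix.toLpLin_apply, Matrix.dotProduct_mulVec, Matrix.vecMul_vecMul,
      Matrix.mulVec_transpose]
    rw [← Matrix.mulVec_transpose M t.ofLp, Matrix.dotProduct_mulVec, Matrix.vecMul_vecMul]
  exact key.comp hX

theorem hasLaw_add_gaussian {μ : Measure Ω} {s : ℕ} {S₁ S₂ : Matrix (Fin s) (Fin s) ℝ}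
    (h₁ : S₁.PosSemidef) (h₂ : S₂.PosSemidef) {X Y : Ω → Vec s}
    (hX : HasLaw X (multivariateGaussian 0 S₁) μ) (hY : HasLaw Y (multivariateGaussian 0 S₂) μ)
    (h : IndepFun X Y μ) :
    HasLaw (fun ω => X ω + Y ω) (multivariateGaussian 0 (S₁ + S₂)) μ := by
  have : IsProbabilityMeasure μ := hX.isProbabilityMeasure
  have hm : AEMeasurable (fun ω => X ω + Y ω) μ := hX.aemeasurable.add hY.aemeasurable
  refine ⟨hm, ?_⟩
  have : IsProbabilityMeasure (μ.map fun ω => X ω + Y ω) := Measure.isProbabilityMeasure_map hm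
  refine Measure.ext_of_charFun ?_
  have := h.charFun_map_add_eq_mul hX.aemeasurable hY.aemeasurable
  rw [show (fun ω => X ω + Y ω) = X + Y from rfl, this, hX.map_eq, hY.map_eq]
  ext t
  rw [Pi.mul_apply, charFun_multivariateGaussian h₁, charFun_multivariateGaussian h₂,
    charFun_multivariateGaussian (h₁.add h₂), ← Complex.exp_add]
  congr 1
  simp [Matrix.add_mulVec]
  ring

/-! ### One-sided shift of an i.i.d. sequence -/

theorem measurePreserving_head_tail {E : Type*} [MeasurableSpace E] (ν : Measure E)
    [IsProbabilityMeasure ν] :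
    MeasurePreserving (fun x : ℕ → E => (x 0, fun i => x (i + 1)))
      (Measure.infinitePi fun _ : ℕ => ν) (ν.prod (Measure.infinitePi fun _ : ℕ => ν)) := by
  refine ⟨by fun_prop, ?_⟩
  have hi : iIndepFun (fun (i : ℕ) (x : ℕ → E) => x i) (Measure.infinitePi fun _ : ℕ => ν) :=
    iIndepFun_infinitePi (P := fun _ => ν) (X := fun _ x => x) (fun _ => measurable_id)
  have h : IndepFun (fun x : ℕ → E => x 0) (fun x i => x (i + 1))
      (Measure.infinitePi fun _ : ℕ => ν) := by
    have := indep_iSup_of_disjoint (fun i => (measurable_pi_apply i).comap_le) hi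
      (S := {0}) (T := Set.Ici 1) (by simp)
    refine indep_of_indep_of_le_left (indep_of_indep_of_le_right this ?_) ?_
    · rw [MeasurableSpace.pi, MeasurableSpace.comap_iSup]
      refine iSup_le fun i => ?_
      rw [MeasurableSpace.comap_comp]
      exact le_iSup₂_of_le (i + 1) (by simp) le_rfl
    · exact le_iSup₂_of_le 0 rfl le_rfl
  rw [(indepFun_iff_map_prod_eq_prod_map_map
      (measurable_pi_apply 0).aemeasurable
      (measurable_pi_lambda _ fun i => measurable_pi_apply (i + 1)).aemeasurable).1 h,
    Measure.infinitePi_map_eval (fun _ : ℕ => ν),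
    Measure.map_infinitePi_infinitePi_of_inj (P := fun _ : ℕ => ν) (add_left_injective 1)]

/-! ### Level sets of quadratic functions of Gaussian vectors -/

theorem finite_setOf_quadratic_eq {a : ℝ} (ha : a ≠ 0) (b c : ℝ) :
    {s : ℝ | a * s ^ 2 + b * s + c = 0}.Finite := by
  have hP : (Polynomial.C a * Polynomial.X ^ 2 + Polynomial.C b * Polynomial.X +
      Polynomial.C c) ≠ 0 := by
    intro h
    have := congrArg (Polynomial.coeff · 2) h
    simp [ha] at this
  refine (Polynomial.finite_setOfPred_isRoot hP).subset fun s hs => ?_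
  simpa [Polynomial.IsRoot] using hs

/-- Gaussian regression: `u` is the covariance of `X` with `f (X)`, divided by the variance of `f
(X)`. The regression residual is uncorrelated with `f (X)`, hence independent of it by joint
Gaussianity. -/
theorem exists_indep_direction {μ : Measure Ω} {E : Type*} [NormedAddCommGroup E] [NormedSpace ℝ E]
    [CompleteSpace E] [SecondCountableTopology E] [MeasurableSpace E] [BorelSpace E]
    {X : Ω → E} (hX : HasGaussianLaw X μ) (f : StrongDual ℝ E) (hf : Var[fun ω => f (X ω); μ] ≠ 0) :
    ∃ u : E, f u = 1 ∧ IndepFun (fun ω => X ω - f (X ω) • u) (fun ω => f (X ω)) μ := by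
  have := hX.isProbabilityMeasure
  set σ := Var[fun ω => f (X ω); μ]
  set c := ∫ ω, f (X ω) ∂μ
  have hfX : MemLp (fun ω => f (X ω)) 2 μ := (hX.map_fun f).memLp_two
  have hint : Integrable (fun ω => (f (X ω) - c) • X ω) μ :=
    memLp_one_iff_integrable.1 (hX.memLp_two.smul (hfX.sub (memLp_const c)))
  have hdual (l : StrongDual ℝ E) :
      l (σ⁻¹ • ∫ ω, (f (X ω) - c) • X ω ∂μ) = σ⁻¹ * cov[fun ω => l (X ω), fun ω => f (X ω); μ] := by
    have hlX : MemLp (fun ω => l (X ω)) 2 μ := (hX.map_fun l).memLp_two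
    rw [map_smul, smul_eq_mul, ← l.integral_comp_comm hint]
    congr 1
    have h1 : cov[fun ω => l (X ω), fun ω => f (X ω); μ]
        = cov[fun ω => l (X ω), fun ω => f (X ω) - c; μ] :=
      (covariance_sub_const_right (hfX.integrable (by norm_num)) c).symm
    have hfc : MemLp (fun ω => f (X ω) - c) 2 μ := hfX.sub (memLp_const c)
    rw [h1, covariance_eq_sub hlX hfc]
    have h0 : ∫ ω, (f (X ω) - c) ∂μ = 0 := by
      rw [integral_sub (hfX.integrable (by norm_num)) (integrable_const c)]; simp [c]
    rw [h0]
    simp [mul_comm]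
  refine ⟨σ⁻¹ • ∫ ω, (f (X ω) - c) • X ω ∂μ, ?_, ?_⟩
  · rw [hdual, covariance_self hfX.aestronglyMeasurable.aemeasurable, inv_mul_cancel₀ hf]
  set u := σ⁻¹ • ∫ ω, (f (X ω) - c) • X ω ∂μ
  have hpair : HasGaussianLaw (fun ω => (X ω - f (X ω) • u, f (X ω))) μ :=
    hX.map_fun ((ContinuousLinearMap.id ℝ E - f.smulRight u).prod f)
  refine hpair.indepFun_of_covariance_strongDual fun l g => ?_
  have hlX : MemLp (fun ω => l (X ω)) 2 μ := (hX.map_fun l).memLp_two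
  have e1 : l ∘ (fun ω => X ω - f (X ω) • u) = (fun ω => l (X ω)) - (l u) • fun ω => f (X ω) := by
    ext ω; simp [mul_comm]
  have e2 : g ∘ (fun ω => f (X ω)) = (g 1) • fun ω => f (X ω) := by
    ext ω
    simp only [Function.comp, Pi.smul_apply, smul_eq_mul]
    rw [mul_comm, ← smul_eq_mul, ← map_smul]; simp
  rw [e1, e2, covariance_smul_right, covariance_sub_left hlX (hfX.const_smul _) hfX,
    covariance_smul_left, covariance_self hfX.aestronglyMeasurable.aemeasurable, hdual l]
  change g 1 * (_ - σ⁻¹ * _ * σ) = 0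
  field_simp
  ring

/-- Given the regression residual `y`, the vector moves along the line `y + s • u` with `s` a
nondegenerate Gaussian. Its law has no atoms, so a finite set of values of `s` is null, and Fubini
concludes. -/
theorem measure_level_eq_zero {μ : Measure Ω} {E : Type*} [NormedAddCommGroup E] [NormedSpace ℝ E]
    [CompleteSpace E] [SecondCountableTopology E] [MeasurableSpace E] [BorelSpace E]
    {X : Ω → E} (hX : HasGaussianLaw X μ) (f : StrongDual ℝ E) (hf : Var[fun ω => f (X ω); μ] ≠ 0)
    {q : E → ℝ} (hq : Measurable q) (h : ℝ)
    (hfin : ∀ u, f u = 1 → ∀ y, {s : ℝ | q (y + s • u) = h}.Finite) :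
    μ {ω | q (X ω) = h} = 0 := by
  have := hX.isProbabilityMeasure
  obtain ⟨u, hu, hind⟩ := exists_indep_direction hX f hf
  have hfG : HasGaussianLaw (fun ω => f (X ω)) μ := hX.map_fun f
  have hY : AEMeasurable (fun ω => X ω - f (X ω) • u) μ := by
    have := hX.aemeasurable
    fun_prop
  have hna : NullSingletonClass (μ.map fun ω => f (X ω)) := by
    rw [hfG.map_eq_gaussianReal]
    refine nullSingletonClass_gaussianReal ?_
    have := variance_nonneg (fun ω => f (X ω)) μ
    simp only [ne_eq, Real.toNNReal_eq_zero, not_le]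
    exact lt_of_le_of_ne this (Ne.symm hf)
  have hms : MeasurableSet {x : E × ℝ | q (x.1 + x.2 • u) = h} := by
    have : Measurable fun x : E × ℝ => q (x.1 + x.2 • u) := hq.comp (by fun_prop)
    exact this (measurableSet_singleton h)
  have hmap := (indepFun_iff_map_prod_eq_prod_map_map hY hfG.aemeasurable).1 hind
  have : μ {ω | q (X ω) = h} =
      μ.map (fun ω => (X ω - f (X ω) • u, f (X ω))) {x : E × ℝ | q (x.1 + x.2 • u) = h} := by
    rw [Measure.map_apply_of_aemeasurable (hY.prodMk hfG.aemeasurable) hms]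
    simp
  rw [this, hmap]
  have := Measure.isProbabilityMeasure_map (μ := μ) hfG.aemeasurable
  rw [Measure.measure_prod_null hms]
  exact Eventually.of_forall fun y => (hfin u hu y).measure_zero _

/-- Off the null level set, the indicator of `h < q x d` is constant for `d` near `d₀`, so the
measures converge. -/
theorem tendsto_measureReal_lt_of_null {E F : Type*} [MeasurableSpace E] (ν : Measure E)
    [IsProbabilityMeasure ν] [TopologicalSpace F] [FirstCountableTopology F] {q : E → F → ℝ}
    (hq : ∀ x, Continuous (q x)) (hm : ∀ d, Measurable fun x => q x d) (d₀ : F) (h : ℝ)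
    (h0 : ν {x | q x d₀ = h} = 0) :
    Tendsto (fun d => ν.real {x | h < q x d}) (𝓝 d₀) (𝓝 (ν.real {x | h < q x d₀})) := by
  refine (ENNReal.tendsto_toReal (measure_ne_top _ _)).comp ?_
  refine tendsto_measure_of_ae_tendsto_indicator_of_isFiniteMeasure (𝓝 d₀)
    (measurableSet_lt measurable_const (hm d₀))
    (fun d => measurableSet_lt measurable_const (hm d)) ?_
  have : ∀ᵐ x ∂ν, q x d₀ ≠ h := by simpa [ae_iff] using h0
  filter_upwards [this] with x hx
  rcases lt_or_gt_of_ne hx with hlt | hgt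
  · filter_upwards [((hq x).tendsto d₀).eventually_lt_const hlt] with d hd
    exact iff_of_false hd.not_gt hlt.not_gt
  · filter_upwards [((hq x).tendsto d₀).eventually_const_lt hgt] with d hd
    exact iff_of_true hd hgt

end

section

variable {n m p : ℕ} {Ω : Type*}

/-! ### The stationary prediction error process -/

/-- A prediction error together with the process and sensor noises from that time on. -/
abbrev Path (n p : ℕ) := Vec n × (ℕ → Vec n) × (ℕ → Vec p)

/-- Residue `C e + v` caused by the prediction error `e`. -/
def Plant.innov (S : Plant n m p) (x : Path n p) : Vec p := act S.C x.1 + x.2.2 0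

/-- Estimation error `e - K (C e + v)` after the measurement update. -/
def Plant.filtErr (S : Plant n m p) (x : Path n p) : Vec n := x.1 - act S.K (S.innov x)

/-- One step of the error dynamics: time update and shift of the noises. -/
def Plant.advance (S : Plant n m p) (x : Path n p) : Path n p :=
  (act S.A (S.filtErr x) + x.2.1 0, fun i => x.2.1 (i + 1), fun i => x.2.2 (i + 1))

/-- The law of `Path`s in steady state. -/
def Plant.pathLaw (S : Plant n m p) : Measure (Path n p) :=
  (multivariateGaussian 0 S.Sig).prod
    ((Measure.infinitePi fun _ : ℕ => multivariateGaussian 0 S.W).prod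
      (Measure.infinitePi fun _ : ℕ => multivariateGaussian 0 S.R))

instance (S : Plant n m p) : IsProbabilityMeasure S.pathLaw := by
  unfold Plant.pathLaw; infer_instance

/-- The initial prediction error and all the noises. -/
def Signals.start (F : Signals n m p Ω) (ω : Ω) : Path n p :=
  (F.x0 ω - F.xbar0 ω, fun t => F.w t ω, fun t => F.v t ω)

@[fun_prop]
theorem Plant.continuous_innov (S : Plant n m p) : Continuous S.innov := by
  unfold Plant.innov; fun_prop

@[fun_prop]
theorem Plant.continuous_filtErr (S : Plant n m p) : Continuous S.filtErr := by
  unfold Plant.filtErr; fun_prop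

@[fun_prop]
theorem Plant.continuous_advance (S : Plant n m p) : Continuous S.advance := by
  unfold Plant.advance; fun_prop

@[fun_prop]
theorem Plant.measurable_advance (S : Plant n m p) : Measurable S.advance :=
  S.continuous_advance.measurable

theorem hasLaw_start [MeasurableSpace Ω] {μ : Measure Ω} {S : Plant n m p} {F : Signals n m p Ω}
    (hF : F.IsGaussian S μ) : HasLaw F.start S.pathLaw μ := by
  have : IsProbabilityMeasure μ := hF.law_init.isProbabilityMeasure
  have hw := hF.indep_w.hasLaw_infinitePi hF.law_w
    (aemeasurable_pi_iff.2 fun t => (hF.law_w t).aemeasurable)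
  have hv := hF.indep_v.hasLaw_infinitePi hF.law_v
    (aemeasurable_pi_iff.2 fun t => (hF.law_v t).aemeasurable)
  exact hF.indep_init.hasLaw_prod hF.law_init (hF.indep_wv.hasLaw_prod hw hv)

theorem Plant.K_mul_Q {S : Plant n m p} (hS : S.IsSteady) : S.K * S.Q = S.Sig * S.Cᵀ := by
  have : IsUnit S.Q.det := (Matrix.isUnit_iff_isUnit_det _).1 hS.posDef_Q.isUnit
  rw [Plant.K, Matrix.mul_assoc, Matrix.nonsing_inv_mul _ this, Matrix.mul_one]

/-- Joseph form of the covariance update: the two sides differ by `K Q Kᵀ - Σ Cᵀ Kᵀ`, which vanishes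
for the Kalman gain. -/
theorem Plant.joseph {S : Plant n m p} (hS : S.IsSteady) :
    (1 - S.K * S.C) * S.Sig * (1 - S.K * S.C)ᵀ + S.K * S.R * S.Kᵀ =
      S.Sig - S.K * S.C * S.Sig := by
  have h : S.K * (S.C * S.Sig * S.Cᵀ + S.R) * S.Kᵀ = S.Sig * S.Cᵀ * S.Kᵀ := by
    rw [← S.K_mul_Q hS]; rfl
  rw [Matrix.mul_add, Matrix.add_mul] at h
  simp only [Matrix.transpose_sub, Matrix.transpose_one, Matrix.transpose_mul]
  rw [← sub_eq_zero, ← sub_eq_zero.2 h]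
  simp only [Matrix.mul_sub, Matrix.sub_mul, Matrix.mul_one, Matrix.one_mul, Matrix.mul_assoc]
  abel

/-- The prediction error after one step, in terms of the current error and current noises. -/
theorem hasLaw_nextErr {S : Plant n m p} (hS : S.IsSteady) :
    HasLaw (fun y : Vec n × Vec n × Vec p =>
        act S.A (y.1 - act S.K (act S.C y.1 + y.2.2)) + y.2.1)
      (multivariateGaussian 0 S.Sig)
      ((multivariateGaussian 0 S.Sig).prod
        ((multivariateGaussian 0 S.W).prod (multivariateGaussian 0 S.R))) := by
  set ν := (multivariateGaussian 0 S.Sig).prod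
        ((multivariateGaussian 0 S.W).prod (multivariateGaussian 0 S.R))
  have he : HasLaw (fun y : Vec n × Vec n × Vec p => y.1) (multivariateGaussian 0 S.Sig) ν :=
    measurePreserving_fst.hasLaw
  have hw : HasLaw (fun y : Vec n × Vec n × Vec p => y.2.1) (multivariateGaussian 0 S.W) ν :=
    (measurePreserving_fst.comp measurePreserving_snd).hasLaw
  have hv : HasLaw (fun y : Vec n × Vec n × Vec p => y.2.2) (multivariateGaussian 0 S.R) ν :=
    (measurePreserving_snd.comp measurePreserving_snd).hasLaw
  have hwv : IndepFun (fun y : Vec n × Vec n × Vec p => y.2.1) (fun y => y.2.2) ν := by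
    rw [indepFun_iff_map_prod_eq_prod_map_map (by fun_prop) (by fun_prop), hw.map_eq, hv.map_eq]
    exact measurePreserving_snd.map_eq
  have hind : IndepFun (fun y : Vec n × Vec n × Vec p => y.1) (fun y => y.2) ν :=
    indepFun_prod (X := id) (Y := id) measurable_id measurable_id
  have h1 := hasLaw_act hS.posSemidef_Sig he (S.A * (1 - S.K * S.C))
  have h2 := hasLaw_act hS.posSemidef_R hv (-(S.A * S.K))
  have p1 : (S.A * (1 - S.K * S.C) * S.Sig * (S.A * (1 - S.K * S.C))ᵀ).PosSemidef := by
    simpa only [Matrix.conjTranspose_eq_transpose_of_trivial] using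
      hS.posSemidef_Sig.mul_mul_conjTranspose_same (S.A * (1 - S.K * S.C))
  have p2 : (-(S.A * S.K) * S.R * (-(S.A * S.K))ᵀ).PosSemidef := by
    simpa using hS.posSemidef_R.mul_mul_conjTranspose_same (-(S.A * S.K))
  have i1 : IndepFun (fun y : Vec n × Vec n × Vec p => y.2.1)
      (fun y => act (-(S.A * S.K)) y.2.2) ν :=
    hwv.comp (φ := id) measurable_id (measurable_act (-(S.A * S.K)))
  have h3 := hasLaw_add_gaussian hS.posSemidef_W p2 hw h2 i1
  have i2 : IndepFun (fun y : Vec n × Vec n × Vec p => act (S.A * (1 - S.K * S.C)) y.1)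
      (fun y => y.2.1 + act (-(S.A * S.K)) y.2.2) ν :=
    hind.comp (measurable_act (S.A * (1 - S.K * S.C)))
      (ψ := fun z : Vec n × Vec p => z.1 + act (-(S.A * S.K)) z.2) (by fun_prop)
  have h4 := hasLaw_add_gaussian p1 (hS.posSemidef_W.add p2) h1 h3 i2
  convert h4 using 2 with y
  · simp only [← act_act, act_sub_left, map_sub, map_add]
    simp [act, Matrix.toLpLin_apply]
    abel
  -- The Joseph form turns the Riccati equation into the sum of the three independent covariance
  -- contributions.
  · have hj := S.joseph hS
    have hr := hS.riccati
    rw [← hj] at hr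
    conv_lhs => rw [hr]
    simp only [Matrix.transpose_mul, Matrix.transpose_neg]
    simp only [Matrix.mul_add, Matrix.add_mul, Matrix.neg_mul, Matrix.mul_neg, Matrix.mul_assoc]
    abel

theorem measurePreserving_prodProdProdComm {α β γ δ : Type*} [MeasurableSpace α]
    [MeasurableSpace β] [MeasurableSpace γ] [MeasurableSpace δ] (a : Measure α) (b : Measure β)
    (c : Measure γ) (d : Measure δ) [SFinite a] [SFinite b] [SFinite c] [SFinite d] :
    MeasurePreserving (fun x : (α × β) × γ × δ => ((x.1.1, x.2.1), x.1.2, x.2.2))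
      ((a.prod b).prod (c.prod d)) ((a.prod c).prod (b.prod d)) := by
  have h1 := measurePreserving_prodAssoc a b (c.prod d)
  have h2 := (MeasurePreserving.id a).prod (measurePreserving_prodAssoc b c d).symm
  have h3 := (MeasurePreserving.id a).prod
    ((Measure.measurePreserving_swap (μ := b) (ν := c)).prod (MeasurePreserving.id d))
  have h4 := (MeasurePreserving.id a).prod (measurePreserving_prodAssoc c b d)
  have h5 := (measurePreserving_prodAssoc a c (b.prod d)).symm
  exact h5.comp (h4.comp (h3.comp (h2.comp h1)))

/-- Stationarity: the heads of both noise sequences are consumed by the update, which reproduces the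
law of the error. The tails are independent of it and again i.i.d. -/
theorem measurePreserving_advance {S : Plant n m p} (hS : S.IsSteady) :
    MeasurePreserving S.advance S.pathLaw S.pathLaw := by
  set ν := (multivariateGaussian 0 S.Sig).prod
        ((multivariateGaussian 0 S.W).prod (multivariateGaussian 0 S.R))
  set tl := (Measure.infinitePi fun _ : ℕ => multivariateGaussian 0 S.W).prod
      (Measure.infinitePi fun _ : ℕ => multivariateGaussian 0 S.R)
  have hsplit : HasLaw (fun x : Path n p =>
      ((x.1, x.2.1 0, x.2.2 0), (fun i => x.2.1 (i + 1)), fun i => x.2.2 (i + 1)))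
      (ν.prod tl) S.pathLaw := by
    have hw := (measurePreserving_head_tail (multivariateGaussian 0 S.W))
    have hv := (measurePreserving_head_tail (multivariateGaussian 0 S.R))
    have h1 := (MeasurePreserving.id (multivariateGaussian 0 S.Sig)).prod (hw.prod hv)
    have h2 := (MeasurePreserving.id (multivariateGaussian 0 S.Sig)).prod
      (measurePreserving_prodProdProdComm (multivariateGaussian 0 S.W)
        (Measure.infinitePi fun _ : ℕ => multivariateGaussian 0 S.W)
        (multivariateGaussian 0 S.R) (Measure.infinitePi fun _ : ℕ => multivariateGaussian 0 S.R))
    have h3 := (measurePreserving_prodAssoc (multivariateGaussian 0 S.Sig)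
      ((multivariateGaussian 0 S.W).prod (multivariateGaussian 0 S.R)) tl).symm
    exact (h3.comp (h2.comp h1)).hasLaw
  have hnext : MeasurePreserving
      (Prod.map (fun y : Vec n × Vec n × Vec p =>
        act S.A (y.1 - act S.K (act S.C y.1 + y.2.2)) + y.2.1)
        (id : (ℕ → Vec n) × (ℕ → Vec p) → _)) (ν.prod tl) S.pathLaw :=
    ((hasLaw_nextErr hS).measurePreserving (by fun_prop)).prod (MeasurePreserving.id tl)
  exact (hnext.hasLaw.comp hsplit).measurePreserving S.measurable_advance

theorem hasLaw_innov {S : Plant n m p} (hS : S.IsSteady) :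
    HasLaw S.innov (multivariateGaussian 0 S.Q) S.pathLaw := by
  have he : HasLaw (fun x : Path n p => x.1) (multivariateGaussian 0 S.Sig) S.pathLaw :=
    measurePreserving_fst.hasLaw
  have hv : HasLaw (fun x : Path n p => x.2.2 0) (multivariateGaussian 0 S.R) S.pathLaw :=
    ((measurePreserving_eval_infinitePi (fun _ : ℕ => multivariateGaussian 0 S.R) 0).comp
      (measurePreserving_snd.comp measurePreserving_snd)).hasLaw
  have hind : IndepFun (fun x : Path n p => act S.C x.1) (fun x => x.2.2 0) S.pathLaw :=
    indepFun_prod (X := act S.C) (Y := fun z : (ℕ → Vec n) × (ℕ → Vec p) => z.2 0)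
      (measurable_act S.C) (by fun_prop)
  have hC : (S.C * S.Sig * S.Cᵀ).PosSemidef := by
    simpa using hS.posSemidef_Sig.mul_mul_conjTranspose_same S.C
  exact hasLaw_add_gaussian hC hS.posSemidef_R (hasLaw_act hS.posSemidef_Sig he S.C) hv hind

theorem hasLaw_iterate [MeasurableSpace Ω] {μ : Measure Ω} {S : Plant n m p} (hS : S.IsSteady)
    {F : Signals n m p Ω} (hF : F.IsGaussian S μ) (t : ℕ) :
    HasLaw (fun ω => S.advance^[t] (F.start ω)) S.pathLaw μ :=
  ((measurePreserving_advance hS).iterate t).hasLaw.comp (hasLaw_start hF)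

/-! ### Deterministic response to the injected signal -/

/-- Contribution of the injected signal `s` to the estimation error. -/
def Plant.attackErr (S : Plant n m p) (s : ℕ → Vec p) : ℕ → Vec n
  | 0 => -act S.K (s 0)
  | t + 1 => act (S.A - S.K * S.C * S.A) (S.attackErr s t) - act S.K (s (t + 1))

/-- Contribution of the injected signal `s` to the residue. -/
def Plant.attackRes (S : Plant n m p) (s : ℕ → Vec p) : ℕ → Vec p
  | 0 => s 0
  | t + 1 => act (S.C * S.A) (S.attackErr s t) + s (t + 1)

theorem advance_iterate_noise (S : Plant n m p) (t i : ℕ) (x : Path n p) :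
    (S.advance^[t] x).2.1 i = x.2.1 (i + t) ∧ (S.advance^[t] x).2.2 i = x.2.2 (i + t) := by
  induction t generalizing i with
  | zero => simp
  | succ t ih =>
    rw [Function.iterate_succ_apply']
    simp only [Plant.advance]
    rw [(ih (i + 1)).1, (ih (i + 1)).2]
    simp [add_assoc, add_comm 1 t]

/-- The terms in `F.u` cancel between state and prediction, which is why an arbitrary
attack-dependent input is harmless. -/
theorem estError_eq (S : Plant n m p) (F : Signals n m p Ω) (s : ℕ → Vec p) (t : ℕ) (ω : Ω) :
    estError S F s t ω = S.filtErr (S.advance^[t] (F.start ω)) + S.attackErr s t := by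
  induction t with
  | zero =>
    simp only [estError, loop, Plant.filtErr, Plant.innov, Function.iterate_zero, id_eq,
      Signals.start, Plant.attackErr, map_add, map_sub]
    abel
  | succ t ih =>
    have hv := (advance_iterate_noise S t 1 (F.start ω)).2
    have hw := (advance_iterate_noise S t 0 (F.start ω)).1
    rw [estError] at ih
    have ih' := eq_add_of_sub_eq ih
    rw [Function.iterate_succ_apply']
    simp only [estError, loop, Plant.filtErr, Plant.innov, Plant.advance, Plant.attackErr] at ih' ⊢
    rw [ih', hw, zero_add, hv, add_comm 1 t]
    simp only [Signals.start, act_sub_left, ← act_act, map_add, map_sub]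
    abel

theorem residue_eq (S : Plant n m p) (F : Signals n m p Ω) (s : ℕ → Vec p) (t : ℕ) (ω : Ω) :
    residue S F s t ω = S.innov (S.advance^[t] (F.start ω)) + S.attackRes s t := by
  cases t with
  | zero =>
    simp only [residue, output, loop, Plant.innov, Function.iterate_zero, id_eq,
      Signals.start, Plant.attackRes, map_sub]
    abel
  | succ t =>
    have ih := estError_eq S F s t ω
    have hv := (advance_iterate_noise S t 1 (F.start ω)).2
    have hw := (advance_iterate_noise S t 0 (F.start ω)).1
    rw [estError] at ih
    have ih' := eq_add_of_sub_eq ih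
    rw [Function.iterate_succ_apply']
    simp only [residue, output, loop, Plant.innov, Plant.advance, Plant.attackRes]
    rw [ih', hw, zero_add, hv, add_comm 1 t]
    simp only [Signals.start, ← act_act, map_add]
    abel

end

section

variable {n m p : ℕ} {Ω : Type*}

/-! ### Windows of residues -/

/-- The first `T` residues along a path. -/
def Plant.window (S : Plant n m p) (T : ℕ) (x : Path n p) : Fin T → Vec p :=
  fun j => S.innov (S.advance^[j] x)

@[fun_prop]
theorem Plant.continuous_window (S : Plant n m p) (T : ℕ) : Continuous (S.window T) :=
  continuous_pi fun j => S.continuous_innov.comp (S.continuous_advance.iterate j)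

@[fun_prop]
theorem Plant.measurable_window (S : Plant n m p) (T : ℕ) : Measurable (S.window T) :=
  (S.continuous_window T).measurable

theorem Plant.innov_add (S : Plant n m p) (x y : Path n p) :
    S.innov (x + y) = S.innov x + S.innov y := by
  simp only [Plant.innov, Prod.fst_add, Prod.snd_add, Pi.add_apply, map_add]
  abel

theorem Plant.innov_smul (S : Plant n m p) (c : ℝ) (x : Path n p) :
    S.innov (c • x) = c • S.innov x := by
  simp [Plant.innov]

theorem Plant.advance_add (S : Plant n m p) (x y : Path n p) :
    S.advance (x + y) = S.advance x + S.advance y := by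
  refine Prod.ext ?_ rfl
  simp only [Plant.advance, Plant.filtErr, S.innov_add, Prod.fst_add, Prod.snd_add, Pi.add_apply,
    map_add, map_sub]
  abel

theorem Plant.advance_smul (S : Plant n m p) (c : ℝ) (x : Path n p) :
    S.advance (c • x) = c • S.advance x := by
  refine Prod.ext ?_ rfl
  simp [Plant.advance, Plant.filtErr, S.innov_smul, smul_sub]

theorem Plant.advance_iterate_add (S : Plant n m p) (t : ℕ) (x y : Path n p) :
    S.advance^[t] (x + y) = S.advance^[t] x + S.advance^[t] y :=
  Function.Semiconj₂.iterate (fun a b => S.advance_add a b) t x y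

theorem Plant.advance_iterate_smul (S : Plant n m p) (t : ℕ) (c : ℝ) (x : Path n p) :
    S.advance^[t] (c • x) = c • S.advance^[t] x :=
  Function.Commute.iterate_left (f := S.advance) (g := fun x => c • x)
    (fun a => S.advance_smul c a) t x

/-- The path with given initial error and first `T` noises, and no noise afterwards. -/
def extendPath (T : ℕ) (y : Vec n × (Fin T → Vec n) × (Fin T → Vec p)) : Path n p :=
  (y.1, fun i => if h : i < T then y.2.1 ⟨i, h⟩ else 0,
    fun i => if h : i < T then y.2.2 ⟨i, h⟩ else 0)

/-- The initial error and the first `T` noises of a path. -/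
def truncatePath (T : ℕ) (x : Path n p) : Vec n × (Fin T → Vec n) × (Fin T → Vec p) :=
  (x.1, fun i => x.2.1 i, fun i => x.2.2 i)

theorem advance_iterate_fst_congr (S : Plant n m p) (t : ℕ) {x y : Path n p} (h1 : x.1 = y.1)
    (hw : ∀ i < t, x.2.1 i = y.2.1 i) (hv : ∀ i < t, x.2.2 i = y.2.2 i) :
    (S.advance^[t] x).1 = (S.advance^[t] y).1 := by
  induction t with
  | zero => simpa
  | succ t ih =>
    have := ih (fun i hi => hw i (by omega)) (fun i hi => hv i (by omega))
    rw [Function.iterate_succ_apply', Function.iterate_succ_apply']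
    simp only [Plant.advance, Plant.filtErr, Plant.innov]
    rw [this, (advance_iterate_noise S t 0 x).1, (advance_iterate_noise S t 0 x).2,
      (advance_iterate_noise S t 0 y).1, (advance_iterate_noise S t 0 y).2, zero_add,
      hw t (by omega), hv t (by omega)]

/-- A residue window depends on finitely many noises only. This moves Gaussianity from the sequence
space, which carries no norm, to a finite-dimensional normed space. -/
theorem window_extend_truncate (S : Plant n m p) (T : ℕ) (x : Path n p) :
    S.window T (extendPath T (truncatePath T x)) = S.window T x := by
  funext j
  have hj := j.2
  simp only [Plant.window, Plant.innov]
  rw [(advance_iterate_noise S j 0 _).2, (advance_iterate_noise S j 0 _).2,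
    advance_iterate_fst_congr S j (x := extendPath T (truncatePath T x)) (y := x) rfl]
  · simp [extendPath, truncatePath]
  · intro i hi; simp [extendPath, truncatePath, hi.trans hj]
  · intro i hi; simp [extendPath, truncatePath, hi.trans hj]

/-- The window of residues as a continuous linear function of finitely many Gaussian vectors. -/
def Plant.windowCLM (S : Plant n m p) (T : ℕ) :
    (Vec n × (Fin T → Vec n) × (Fin T → Vec p)) →L[ℝ] (Fin T → Vec p) where
  toFun y := S.window T (extendPath T y)
  map_add' x y := by
    have : extendPath T (x + y) = extendPath T x + extendPath T y := by
      refine Prod.ext rfl (Prod.ext ?_ ?_) <;> funext i <;> by_cases h : i < T <;>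
        simp [extendPath, h]
    funext j
    simp [Plant.window, this, S.advance_iterate_add, S.innov_add]
  map_smul' c x := by
    have : extendPath T (c • x) = c • extendPath T x := by
      refine Prod.ext rfl (Prod.ext ?_ ?_) <;> funext i <;> by_cases h : i < T <;>
        simp [extendPath, h]
    funext j
    simp [Plant.window, this, S.advance_iterate_smul, S.innov_smul]
  cont := by
    refine (S.continuous_window T).comp ?_
    refine continuous_fst.prodMk (Continuous.prodMk ?_ ?_) <;> refine continuous_pi fun i => ?_ <;>
      by_cases h : i < T <;> simp only [h, dite_true, dite_false] <;> fun_prop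

theorem hasGaussianLaw_restrict {ι : Type*} [Fintype ι] {E : Type*} [NormedAddCommGroup E]
    [NormedSpace ℝ E] [CompleteSpace E] [SecondCountableTopology E] [MeasurableSpace E]
    [BorelSpace E] (ν : Measure E) [IsGaussian ν] {f : ι → ℕ} (hf : Function.Injective f) :
    HasGaussianLaw (fun (x : ℕ → E) (i : ι) => x (f i)) (Measure.infinitePi fun _ : ℕ => ν) := by
  have hi : iIndepFun (fun (i : ℕ) (x : ℕ → E) => x i) (Measure.infinitePi fun _ : ℕ => ν) :=
    iIndepFun_infinitePi (P := fun _ => ν) (X := fun _ x => x) (fun _ => measurable_id)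
  exact (hi.precomp hf).hasGaussianLaw fun i =>
    (measurePreserving_eval_infinitePi (fun _ : ℕ => ν) (f i)).hasLaw.hasGaussianLaw

theorem hasGaussianLaw_truncatePath (S : Plant n m p) (T : ℕ) :
    HasGaussianLaw (truncatePath T) S.pathLaw := by
  have hT : Function.Injective (fun i : Fin T => (i : ℕ)) := Fin.val_injective
  have hw := hasGaussianLaw_restrict (multivariateGaussian 0 S.W) hT
  have hv := hasGaussianLaw_restrict (multivariateGaussian 0 S.R) hT
  refine ⟨?_⟩
  have := hw.isGaussian_map
  have := hv.isGaussian_map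
  have mw : Measurable fun (x : ℕ → Vec n) (i : Fin T) => x i := by fun_prop
  have mv : Measurable fun (x : ℕ → Vec p) (i : Fin T) => x i := by fun_prop
  have h : S.pathLaw.map (truncatePath T) = (multivariateGaussian 0 S.Sig).prod
      (((Measure.infinitePi fun _ : ℕ => multivariateGaussian 0 S.W).map
          fun x (i : Fin T) => x i).prod
        ((Measure.infinitePi fun _ : ℕ => multivariateGaussian 0 S.R).map
          fun x (i : Fin T) => x i)) :=
    ((MeasurePreserving.id _).prod ((mw.measurePreserving _).prod (mv.measurePreserving _))).map_eq
  rw [h]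
  infer_instance

theorem hasGaussianLaw_window (S : Plant n m p) (T : ℕ) :
    HasGaussianLaw (S.window T) S.pathLaw := by
  have := (hasGaussianLaw_truncatePath S T).map_fun (S.windowCLM T)
  refine this.congr (Eventually.of_forall fun x => ?_)
  exact window_extend_truncate S T x

theorem hasLaw_window_apply {S : Plant n m p} (hS : S.IsSteady) {T : ℕ} (j : Fin T) :
    HasLaw (fun x => S.window T x j) (multivariateGaussian 0 S.Q) S.pathLaw :=
  (hasLaw_innov hS).comp ((measurePreserving_advance hS).iterate j).hasLaw

/-! ### The detection function of a window -/

theorem continuous_quad {r : ℕ} (M : Matrix (Fin r) (Fin r) ℝ) : Continuous (quad M) := by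
  unfold quad; fun_prop

theorem quad_add_smul {r : ℕ} (M : Matrix (Fin r) (Fin r) ℝ) (x y : Vec r) (s : ℝ) :
    quad M (x + s • y) = quad M y * s ^ 2 +
      (x.ofLp ⬝ᵥ (M *ᵥ y.ofLp) + y.ofLp ⬝ᵥ (M *ᵥ x.ofLp)) * s + quad M x := by
  simp only [quad, WithLp.ofLp_add, WithLp.ofLp_smul, Matrix.mulVec_add, Matrix.mulVec_smul,
    add_dotProduct, dotProduct_add, smul_dotProduct, dotProduct_smul, smul_eq_mul]
  ring

theorem quad_nonneg {r : ℕ} {M : Matrix (Fin r) (Fin r) ℝ} (hM : M.PosDef) (x : Vec r) :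
    0 ≤ quad M x := by
  simpa [quad] using hM.posSemidef.dotProduct_mulVec_nonneg x.ofLp

theorem quad_pos {r : ℕ} {M : Matrix (Fin r) (Fin r) ℝ} (hM : M.PosDef) {x : Vec r} (hx : x ≠ 0) :
    0 < quad M x := by
  have : x.ofLp ≠ 0 := by simpa using hx
  simpa [quad] using hM.dotProduct_mulVec_pos this

/-- The constant is the minimum of the form on the compact unit sphere, extended by homogeneity; an
empty sphere forces the space to be trivial. -/
theorem exists_mul_norm_sq_le_quad {r : ℕ} {M : Matrix (Fin r) (Fin r) ℝ} (hM : M.PosDef) :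
    ∃ l > 0, ∀ x : Vec r, l * ‖x‖ ^ 2 ≤ quad M x := by
  rcases (Metric.sphere (0 : Vec r) 1).eq_empty_or_nonempty with h | h
  · refine ⟨1, one_pos, fun x => ?_⟩
    have hx : x = 0 := by
      by_contra hx
      have : ‖x‖⁻¹ • x ∈ Metric.sphere (0 : Vec r) 1 := by simp [norm_smul, hx]
      simp [h] at this
    simpa [hx] using quad_nonneg hM (0 : Vec r)
  · obtain ⟨y, hy, hmin⟩ := (isCompact_sphere (0 : Vec r) 1).exists_isMinOn h
      (continuous_quad M).continuousOn
    have hy0 : y ≠ 0 := by rintro rfl; simp at hy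
    refine ⟨quad M y, quad_pos hM hy0, fun x => ?_⟩
    by_cases hx : x = 0
    · simpa [hx] using quad_nonneg hM (0 : Vec r)
    have h1 : ‖x‖⁻¹ • x ∈ Metric.sphere (0 : Vec r) 1 := by simp [norm_smul, hx]
    have h2 : quad M y ≤ quad M (‖x‖⁻¹ • x) := hmin h1
    have h3 := quad_add_smul M 0 x ‖x‖⁻¹
    simp only [zero_add] at h3
    have hn : 0 < ‖x‖ := norm_pos_iff.2 hx
    rw [h3] at h2
    simp [quad] at h2 ⊢
    field_simp at h2
    linarith

/-- Weighted sum of squared normalized residues. -/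
def Plant.windowStat (S : Plant n m p) (c : ℕ → ℝ) (T : ℕ) (z : Fin T → Vec p) : ℝ :=
  ∑ i : Fin T, c (i + 1) * quad S.Q⁻¹ (z i)

@[fun_prop]
theorem Plant.continuous_windowStat (S : Plant n m p) (c : ℕ → ℝ) (T : ℕ) :
    Continuous (S.windowStat c T) :=
  continuous_finsetSum _ fun i _ =>
    continuous_const.mul ((continuous_quad _).comp (continuous_apply i))

@[fun_prop]
theorem Plant.measurable_windowStat (S : Plant n m p) (c : ℕ → ℝ) (T : ℕ) :
    Measurable (S.windowStat c T) :=
  (S.continuous_windowStat c T).measurable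

theorem mul_quad_last_le_windowStat {S : Plant n m p} (hS : S.IsSteady) {c : ℕ → ℝ} {T : ℕ}
    (hc : ∀ j, 1 ≤ j → 0 ≤ c j) (z : Fin (T + 1) → Vec p) :
    c (T + 1) * quad S.Q⁻¹ (z (Fin.last T)) ≤ S.windowStat c (T + 1) z := by
  have := Finset.single_le_sum (f := fun i : Fin (T + 1) => c (i + 1) * quad S.Q⁻¹ (z i))
    (fun i _ => mul_nonneg (hc _ (by omega)) (quad_nonneg hS.posDef_Q.inv _))
    (Finset.mem_univ (Fin.last T))
  simpa [Plant.windowStat] using this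

/-- Probability that the detection function of a stationary window of residues, shifted by `d`,
exceeds `h`. -/
def Plant.windowAlarm (S : Plant n m p) (c : ℕ → ℝ) (T : ℕ) (h : ℝ) (d : Fin T → Vec p) : ℝ :=
  S.pathLaw.real {x | h < S.windowStat c T (S.window T x + d)}

/-- The functional `f` is coordinate `i` of the last residue, with variance `Q i i > 0`. A direction
`u` with `f u = 1` has nonzero last block. So along `u` the statistic is a quadratic polynomial with
positive leading coefficient, thanks to the positive last weight. -/
theorem measure_windowStat_eq_zero {S : Plant n m p} (hS : S.IsSteady) {c : ℕ → ℝ} {T : ℕ}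
    (hc : ∀ j, 1 ≤ j → 0 ≤ c j) (hcT : 0 < c (T + 1)) (h : ℝ) (i : Fin p) :
    S.pathLaw {x | S.windowStat c (T + 1) (S.window (T + 1) x) = h} = 0 := by
  let f : StrongDual ℝ (Fin (T + 1) → Vec p) :=
    (EuclideanSpace.proj i).comp (ContinuousLinearMap.proj (Fin.last T))
  have hQ := hS.posDef_Q
  refine measure_level_eq_zero (hasGaussianLaw_window S (T + 1)) f ?_
    (S.measurable_windowStat c (T + 1)) h fun u hu y => ?_
  · have h1 := hasLaw_window_apply hS (Fin.last T)
    have h2 := h1.covariance_fun_comp (f := fun z => z i) (g := fun z => z i)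
      (by fun_prop) (by fun_prop)
    rw [covariance_eval_multivariateGaussian hQ.posSemidef, covariance_self (by fun_prop)] at h2
    change Var[fun x => S.window (T + 1) x (Fin.last T) i; S.pathLaw] ≠ 0
    rw [h2]
    exact hQ.diag_pos.ne'
  · have hu0 : u (Fin.last T) ≠ 0 := by
      intro h0
      simp [f, h0] at hu
    have hpos : 0 < S.windowStat c (T + 1) u :=
      (mul_pos hcT (quad_pos hQ.inv hu0)).trans_le (mul_quad_last_le_windowStat hS hc u)
    refine (finite_setOf_quadratic_eq hpos.ne'
      (∑ j : Fin (T + 1), c (j + 1) * ((y j).ofLp ⬝ᵥ (S.Q⁻¹ *ᵥ (u j).ofLp) +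
        (u j).ofLp ⬝ᵥ (S.Q⁻¹ *ᵥ (y j).ofLp))) (S.windowStat c (T + 1) y - h)).subset fun s hs => ?_
    have hs' : S.windowStat c (T + 1) (y + s • u) = h := hs
    have hexp : S.windowStat c (T + 1) (y + s • u) = S.windowStat c (T + 1) u * s ^ 2 +
        (∑ j : Fin (T + 1), c (j + 1) * ((y j).ofLp ⬝ᵥ (S.Q⁻¹ *ᵥ (u j).ofLp) +
        (u j).ofLp ⬝ᵥ (S.Q⁻¹ *ᵥ (y j).ofLp))) * s + S.windowStat c (T + 1) y := by
      simp only [Plant.windowStat, Pi.add_apply, Pi.smul_apply, quad_add_smul, Finset.sum_mul]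
      rw [← Finset.sum_add_distrib, ← Finset.sum_add_distrib]
      exact Finset.sum_congr rfl fun j _ => by ring
    rw [Set.mem_ofPred_eq]
    linarith

theorem eventually_windowAlarm_le {S : Plant n m p} (hS : S.IsSteady) {c : ℕ → ℝ} {T : ℕ}
    (hc : ∀ j, 1 ≤ j → 0 ≤ c j) (hT : 1 ≤ T) (hcT : 0 < c T) (h : ℝ) {ε : ℝ} (hε : 0 < ε) :
    ∀ᶠ δ in 𝓝[>] (0 : ℝ), ∀ d : Fin T → Vec p, (∀ i, ‖d i‖ ≤ δ) →
      S.windowAlarm c T h d ≤ S.windowAlarm c T h 0 + ε := by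
  obtain ⟨T, rfl⟩ : ∃ T', T = T' + 1 := ⟨T - 1, by omega⟩
  -- Without sensors the statistic is constantly `0` and a level set may have full measure, but then
  -- `0` is the only shift.
  rcases isEmpty_or_nonempty (Fin p) with hp | ⟨⟨i⟩⟩
  · refine Eventually.of_forall fun δ d _ => ?_
    rw [Subsingleton.elim d 0]
    linarith
  have hlim := tendsto_measureReal_lt_of_null S.pathLaw
    (q := fun x d => S.windowStat c (T + 1) (S.window (T + 1) x + d))
    (fun x => by fun_prop) (fun d => by fun_prop) (0 : Fin (T + 1) → Vec p) h
    (by simpa using measure_windowStat_eq_zero hS hc hcT h i)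
  have hev := hlim.eventually_lt_const (lt_add_of_pos_right _ hε)
  obtain ⟨r, hr, hball⟩ := Metric.eventually_nhds_iff.1 hev
  filter_upwards [Ioo_mem_nhdsGT hr] with δ hδ d hd
  refine (hball ?_).le
  rw [dist_zero_right]
  exact ((pi_norm_le_iff_of_nonneg hδ.1.le).2 hd).trans_lt hδ.2

/-- The event of no alarm has probability at least `1 - b`, so it meets the event that the noise
part of the last residue is below `r`. At a common path the shifted last residue is bounded by the
threshold, and `d` is the difference of two bounded vectors. -/
theorem eventually_norm_last_le {S : Plant n m p} (hS : S.IsSteady) {c : ℕ → ℝ} {T : ℕ}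
    (hc : ∀ j, 1 ≤ j → 0 ≤ c j) (hcT : 0 < c (T + 1)) (h : ℝ) {b : ℝ} (hb : b < 1) :
    ∀ᶠ M in atTop, ∀ d : Fin (T + 1) → Vec p, S.windowAlarm c (T + 1) h d ≤ b →
      ‖d (Fin.last T)‖ ≤ M := by
  obtain ⟨l, hl, hquad⟩ := exists_mul_norm_sq_le_quad hS.posDef_Q.inv
  have hint : Integrable (fun x => ‖S.window (T + 1) x (Fin.last T)‖) S.pathLaw :=
    (hasLaw_window_apply hS (Fin.last T)).hasGaussianLaw.integrable.norm
  set I := ∫ x, ‖S.window (T + 1) x (Fin.last T)‖ ∂S.pathLaw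
  have hI : 0 ≤ I := integral_nonneg fun _ => norm_nonneg _
  -- Chosen so that `I < r * (1 - b)`, which makes Markov's bound strictly smaller than `1 - b`.
  set r := I / (1 - b) + 1
  have hb' : 0 < 1 - b := by linarith
  have hr : 0 < r := by positivity
  have hmarkov : S.pathLaw.real {x | r ≤ ‖S.window (T + 1) x (Fin.last T)‖} < 1 - b := by
    have h1 := mul_meas_ge_le_integral_of_nonneg
      (Eventually.of_forall fun x => norm_nonneg (S.window (T + 1) x (Fin.last T))) hint r
    have h2 : I < r * (1 - b) := by
      simp only [r]; field_simp; linarith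
    by_contra hcon
    have := mul_le_mul_of_nonneg_left (not_lt.1 hcon) hr.le
    linarith
  filter_upwards [eventually_ge_atTop (r + √(h / (c (T + 1) * l)))] with M hM d hd
  refine le_trans ?_ hM
  obtain ⟨x, hx1, hx2⟩ : ∃ x, S.windowStat c (T + 1) (S.window (T + 1) x + d) ≤ h ∧
      ‖S.window (T + 1) x (Fin.last T)‖ < r := by
    by_contra! hcon
    have hms : MeasurableSet {x | h < S.windowStat c (T + 1) (S.window (T + 1) x + d)} :=
      measurableSet_lt measurable_const (by fun_prop)
    have hcompl := probReal_compl_eq_one_sub (μ := S.pathLaw) hms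
    have hsub : {x | h < S.windowStat c (T + 1) (S.window (T + 1) x + d)}ᶜ ⊆
        {x | r ≤ ‖S.window (T + 1) x (Fin.last T)‖} := fun x hx => hcon x (not_lt.1 hx)
    have := measureReal_mono (μ := S.pathLaw) hsub
    rw [Plant.windowAlarm] at hd
    linarith
  have h1 := (mul_quad_last_le_windowStat hS hc (S.window (T + 1) x + d)).trans hx1
  have h2 := mul_le_mul_of_nonneg_left (hquad ((S.window (T + 1) x + d) (Fin.last T))) hcT.le
  have h3 : ‖(S.window (T + 1) x + d) (Fin.last T)‖ ≤ √(h / (c (T + 1) * l)) := by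
    refine Real.le_sqrt_of_sq_le ?_
    rw [le_div_iff₀ (by positivity)]
    linarith
  have h4 : d (Fin.last T) =
      (S.window (T + 1) x + d) (Fin.last T) - S.window (T + 1) x (Fin.last T) := by simp
  rw [h4]
  exact (norm_sub_le _ _).trans (by linarith)

end

section

variable {n m p : ℕ} {Ω : Type*}

/-! ### Alarm probabilities and moments under attack -/

theorem detection_eq (S : Plant n m p) (F : Signals n m p Ω) (N : ℕ) {D : Detector}
    (hD : D.IsAdmissible N) (a : ℕ → Vec p) {k : ℕ} (hk : 1 ≤ k) (ω : Ω) :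
    detection S F N D a k ω = S.windowStat D.c (D.T k)
      (S.window (D.T k) (S.advance^[N + k + 1 - D.T k] (F.start ω)) +
        fun i : Fin (D.T k) => S.attackRes (injected N a) (N + k + 1 - D.T k + i)) := by
  have hle := hD.le k hk
  simp only [detection, Plant.windowStat, Plant.window, Pi.add_apply]
  rw [← Finset.sum_range
    (fun i => D.c (i + 1) * quad S.Q⁻¹
      (S.innov (S.advance^[i] (S.advance^[N + k + 1 - D.T k] (F.start ω))) +
        S.attackRes (injected N a) (N + k + 1 - D.T k + i)))]
  -- Shifting `j` to `i + 1` makes the window start at step `N + k + 1 - D.T k`, where `hle` keeps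
  -- the subtraction exact.
  rw [← Finset.Ico_add_one_right_eq_Icc, Finset.sum_Ico_eq_sum_range]
  refine Finset.sum_congr rfl fun i _ => ?_
  rw [residue_eq, ← Function.iterate_add_apply,
    show N + k + (1 + i) - D.T k = N + k + 1 - D.T k + i by omega, add_comm 1 i,
    add_comm i (N + k + 1 - D.T k)]

/-- By stationarity the starting step of the window drops out of the noise part. -/
theorem alarm_eq [MeasurableSpace Ω] {μ : Measure Ω} {S : Plant n m p} (hS : S.IsSteady)
    {F : Signals n m p Ω} (hF : F.IsGaussian S μ) {N : ℕ} {D : Detector} (hD : D.IsAdmissible N)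
    (a : ℕ → Vec p) {k : ℕ} (hk : 1 ≤ k) :
    alarm S F μ N D a k = S.windowAlarm D.c (D.T k) D.h
      (fun i => S.attackRes (injected N a) (N + k + 1 - D.T k + i)) := by
  simp only [alarm, detection_eq S F N hD a hk]
  exact (hasLaw_iterate hS hF (N + k + 1 - D.T k)).measureReal_eq
    (p := fun x => D.h < S.windowStat D.c (D.T k) (S.window (D.T k) x +
      fun i : Fin (D.T k) => S.attackRes (injected N a) (N + k + 1 - D.T k + i)))
    (measurableSet_lt measurable_const (by fun_prop))

theorem attackErr_attackRes_congr (S : Plant n m p) {s s' : ℕ → Vec p} {t : ℕ}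
    (h : ∀ i ≤ t, s i = s' i) :
    S.attackErr s t = S.attackErr s' t ∧ S.attackRes s t = S.attackRes s' t := by
  induction t with
  | zero => simp [Plant.attackErr, Plant.attackRes, h 0 le_rfl]
  | succ t ih =>
    simp [Plant.attackErr, Plant.attackRes, h (t + 1) le_rfl, (ih fun i hi => h i (by omega)).1]

theorem attackErr_attackRes_zero (S : Plant n m p) (t : ℕ) :
    S.attackErr 0 t = 0 ∧ S.attackRes 0 t = 0 := by
  induction t with
  | zero => simp [Plant.attackErr, Plant.attackRes]
  | succ t ih => simp [Plant.attackErr, Plant.attackRes, ih.1]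

theorem attackErr_attackRes_injected_of_le (S : Plant n m p) {N : ℕ} (a : ℕ → Vec p) {t : ℕ}
    (ht : t ≤ N) : S.attackErr (injected N a) t = 0 ∧ S.attackRes (injected N a) t = 0 := by
  have h := attackErr_attackRes_congr S (s := injected N a) (s' := 0) (t := t)
    fun i hi => by simp [injected, (hi.trans ht).not_gt]
  rw [h.1, h.2]
  exact attackErr_attackRes_zero S t

theorem injected_zero (N : ℕ) : injected N (0 : ℕ → Vec p) = 0 := by
  funext t; simp [injected]

theorem alarm_zero_eq [MeasurableSpace Ω] {μ : Measure Ω} {S : Plant n m p} (hS : S.IsSteady)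
    {F : Signals n m p Ω} (hF : F.IsGaussian S μ) {N : ℕ} {D : Detector} (hD : D.IsAdmissible N)
    {k : ℕ} (hk : 1 ≤ k) :
    alarm S F μ N D 0 k = S.windowAlarm D.c (D.T k) D.h 0 := by
  rw [alarm_eq hS hF hD 0 hk, injected_zero]
  congr 1
  funext i
  exact (attackErr_attackRes_zero S _).2

/-- Attacks with small residue increments up to time `k` are stealthy at time `k`. -/
theorem eventually_alarm_le [MeasurableSpace Ω] {μ : Measure Ω} {S : Plant n m p}
    (hS : S.IsSteady) {F : Signals n m p Ω} (hF : F.IsGaussian S μ) {N : ℕ} {D : Detector}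
    (hD : D.IsAdmissible N) {ε : ℝ} (hε : 0 < ε) {τ : ℕ} (hτ : ∃ k, 1 ≤ k ∧ D.T k = τ) :
    ∀ᶠ δ in 𝓝[>] (0 : ℝ), ∀ k, 1 ≤ k → D.T k = τ → ∀ a : ℕ → Vec p,
      (∀ k', 1 ≤ k' → k' ≤ k → ‖S.attackRes (injected N a) (N + k')‖ ≤ δ) →
      alarm S F μ N D a k ≤ alarm S F μ N D 0 k + ε := by
  obtain ⟨k₀, hk₀, rfl⟩ := hτ
  filter_upwards [eventually_windowAlarm_le hS hD.nonneg (hD.one_le k₀ hk₀) (hD.pos k₀ hk₀) D.h hε,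
    self_mem_nhdsWithin] with δ hδ hδ0 k hk hkT a ha
  rw [alarm_eq hS hF hD a hk, alarm_zero_eq hS hF hD hk, hkT]
  refine hδ _ fun i => ?_
  have hle := hD.le k hk
  rw [hkT] at hle
  have hi := i.2
  -- The window may reach back to steps before the attack, where the increments vanish.
  rcases le_or_gt (N + k + 1 - D.T k₀ + i) N with h | h
  · rw [(attackErr_attackRes_injected_of_le S a h).2, norm_zero]
    exact le_of_lt hδ0
  · obtain ⟨k', hk'⟩ := Nat.exists_eq_add_of_lt h
    rw [hk', add_assoc N k' 1]
    exact ha (k' + 1) (by omega) (by omega)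

/-- The residue increment of an attack that is stealthy at time `k` is bounded. -/
theorem eventually_norm_attackRes_le [MeasurableSpace Ω] {μ : Measure Ω} {S : Plant n m p}
    (hS : S.IsSteady) {F : Signals n m p Ω} (hF : F.IsGaussian S μ) {N : ℕ} {D : Detector}
    (hD : D.IsAdmissible N) {ε : ℝ} {τ : ℕ}
    (hτ : ∃ k, 1 ≤ k ∧ D.T k = τ ∧ ε < 1 - alarm S F μ N D 0 k) :
    ∀ᶠ M in atTop, ∀ k, 1 ≤ k → D.T k = τ → ∀ a : ℕ → Vec p,
      alarm S F μ N D a k ≤ alarm S F μ N D 0 k + ε →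
      ‖S.attackRes (injected N a) (N + k)‖ ≤ M := by
  obtain ⟨k₀, hk₀, rfl, hk₀ε⟩ := hτ
  have hone := hD.one_le k₀ hk₀
  have hpos := hD.pos k₀ hk₀
  obtain ⟨T, hT⟩ : ∃ T, D.T k₀ = T + 1 := ⟨D.T k₀ - 1, by omega⟩
  rw [alarm_zero_eq hS hF hD hk₀, hT] at hk₀ε
  rw [hT] at hpos
  -- The attack-free alarm probability depends on the window length only, so the hypothesis at `k₀`
  -- serves every `k` with this length.
  have hb : S.windowAlarm D.c (T + 1) D.h 0 + ε < 1 := by linarith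
  filter_upwards [eventually_norm_last_le hS hD.nonneg hpos D.h hb] with M hM k hk hkT a ha
  rw [alarm_eq hS hF hD a hk, alarm_zero_eq hS hF hD hk, hkT, hT] at ha
  have hle := hD.le k hk
  have := hM _ ha
  rwa [Fin.val_last, show N + k + 1 - (T + 1) + T = N + k by omega] at this

theorem memLp_filtErr (S : Plant n m p) : MemLp S.filtErr 2 S.pathLaw := by
  have h1 : HasGaussianLaw (fun x : Path n p => x.1) S.pathLaw :=
    (measurePreserving_fst : MeasurePreserving _ S.pathLaw _).hasLaw.hasGaussianLaw
  have h2 : HasGaussianLaw S.innov S.pathLaw :=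
    (hasGaussianLaw_window S 1).map_fun (ContinuousLinearMap.proj (R := ℝ) 0)
  have h3 := h2.map_fun (Matrix.toEuclideanLin S.K).toContinuousLinearMap
  exact h1.memLp_two.sub h3.memLp_two

/-- The stationary mean is left unevaluated: only its independence of attack and time matters for
boundedness. -/
theorem integral_estError [MeasurableSpace Ω] {μ : Measure Ω} {S : Plant n m p} (hS : S.IsSteady)
    {F : Signals n m p Ω} (hF : F.IsGaussian S μ) (s : ℕ → Vec p) (t : ℕ) :
    ∫ ω, estError S F s t ω ∂μ = ∫ x, S.filtErr x ∂S.pathLaw + S.attackErr s t := by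
  simp only [estError_eq]
  have h := (hasLaw_iterate hS hF t).integral_comp (f := fun x => S.filtErr x + S.attackErr s t)
    (by fun_prop)
  simp only [Function.comp_def] at h
  rw [h, integral_add ((memLp_filtErr S).integrable (by norm_num)) (integrable_const _)]
  simp

theorem covMat_estError [MeasurableSpace Ω] {μ : Measure Ω} {S : Plant n m p} (hS : S.IsSteady)
    {F : Signals n m p Ω} (hF : F.IsGaussian S μ) (s : ℕ → Vec p) (t : ℕ) :
    covMat μ (estError S F s t) = covMat S.pathLaw S.filtErr := by
  ext i j
  have hi (i : Fin n) : Integrable (fun x => S.filtErr x i) S.pathLaw :=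
    ((EuclideanSpace.proj (𝕜 := ℝ) i).comp_memLp' (memLp_filtErr S)).integrable (by norm_num)
  simp only [covMat, Matrix.of_apply, estError_eq]
  rw [(hasLaw_iterate hS hF t).covariance_fun_comp
    (f := fun x => (S.filtErr x + S.attackErr s t) i)
    (g := fun x => (S.filtErr x + S.attackErr s t) j) (by fun_prop) (by fun_prop)]
  simp only [PiLp.add_apply]
  rw [covariance_add_const_left (hi i), covariance_add_const_right (hi j)]

theorem posSemidef_covMat [MeasurableSpace Ω] {μ : Measure Ω} [IsProbabilityMeasure μ] {d : ℕ}
    {X : Ω → Vec d} (hX : MemLp X 2 μ) : (covMat μ X).PosSemidef := by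
  have hi (i : Fin d) : MemLp (fun ω => X ω i) 2 μ :=
    (EuclideanSpace.proj (𝕜 := ℝ) i).comp_memLp' hX
  refine Matrix.PosSemidef.of_dotProduct_mulVec_nonneg ?_ fun x => ?_
  · ext i j
    simp [covMat, covariance_comm]
  · have h := variance_nonneg (∑ i, x i • fun ω => X ω i) μ
    rw [variance_sum fun i => (hi i).const_smul (x i)] at h
    refine h.trans_eq ?_
    simp only [dotProduct, mulVec, covMat, Matrix.of_apply, covariance_smul_left,
      covariance_smul_right, Finset.mul_sum, Pi.star_apply, star_trivial]
    exact Finset.sum_congr rfl fun i _ => Finset.sum_congr rfl fun j _ => by ring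

/-- The mean itself is reachable: its outer product cancels and leaves `γ` times a covariance
matrix. -/
theorem attackErr_mem_reach [MeasurableSpace Ω] {μ : Measure Ω} {S : Plant n m p}
    (hS : S.IsSteady) {F : Signals n m p Ω} (hF : F.IsGaussian S μ) {N : ℕ} {D : Detector}
    {Ks : Set (Fin p)} {ε γ : ℝ} (hγ : 0 ≤ γ) {k : ℕ} {a : ℕ → Vec p}
    (ha : a ∈ stealthy S F μ N D Ks ε k) :
    ∫ x, S.filtErr x ∂S.pathLaw + S.attackErr (injected N a) (N + k) ∈
      reach S F μ N D Ks ε γ k := by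
  refine ⟨a, ha, ?_⟩
  simp only [integral_estError hS hF, covMat_estError hS hF, add_sub_cancel_left]
  exact (posSemidef_covMat (memLp_filtErr S)).smul hγ

/-- The diagonal of the defining matrix inequality suffices, since coordinatewise bounds control the
norm. -/
theorem sq_apply_le_of_mem_reach [MeasurableSpace Ω] {μ : Measure Ω} {S : Plant n m p}
    (hS : S.IsSteady) {F : Signals n m p Ω} (hF : F.IsGaussian S μ) {N : ℕ} {D : Detector}
    {Ks : Set (Fin p)} {ε γ : ℝ} {k : ℕ} {e : Vec n} (he : e ∈ reach S F μ N D Ks ε γ k) :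
    ∃ a ∈ stealthy S F μ N D Ks ε k, ∀ i, e i ^ 2 ≤
      (∫ x, S.filtErr x ∂S.pathLaw + S.attackErr (injected N a) (N + k)) i ^ 2 +
        γ * covMat S.pathLaw S.filtErr i i := by
  obtain ⟨a, ha, h⟩ := he
  refine ⟨a, ha, fun i => ?_⟩
  have := h.diag_nonneg (i := i)
  simp only [integral_estError hS hF, covMat_estError hS hF, Matrix.sub_apply, Matrix.add_apply,
    Matrix.smul_apply, vecMulVec_apply, smul_eq_mul] at this
  nlinarith

/-! ### The deterministic reachable set -/

theorem attackErr_injected_succ (S : Plant n m p) (N k : ℕ) (a : ℕ → Vec p) :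
    S.attackErr (injected N a) (N + (k + 1)) =
      act (S.A - S.K * S.C * S.A) (S.attackErr (injected N a) (N + k)) - act S.K (a (k + 1)) := by
  have : injected N a (N + k + 1) = a (k + 1) := by
    rw [injected, if_pos (by omega)]; congr 1; omega
  rw [← add_assoc, Plant.attackErr, this]

theorem attackRes_injected_succ (S : Plant n m p) (N k : ℕ) (a : ℕ → Vec p) :
    S.attackRes (injected N a) (N + (k + 1)) =
      act (S.C * S.A) (S.attackErr (injected N a) (N + k)) + a (k + 1) := by
  have : injected N a (N + k + 1) = a (k + 1) := by
    rw [injected, if_pos (by omega)]; congr 1; omega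
  rw [← add_assoc, Plant.attackRes, this]

/-- Unrolls the recursion into a single attack sequence. Changing the attack at time `k + 1` leaves
all earlier responses unchanged, so sequences can be extended one step at a time. -/
theorem mem_reachHat_iff (S : Plant n m p) (Ks : Set (Fin p)) (β : ℝ) (N k : ℕ) (e : Vec n) :
    e ∈ reachHat S Ks β k ↔ ∃ a : ℕ → Vec p, (∀ j, ∀ i, i ∉ Ks → a j i = 0) ∧
      S.attackErr (injected N a) (N + k) = e ∧
      ∀ k', 1 ≤ k' → k' ≤ k → ‖S.attackRes (injected N a) (N + k')‖ ≤ β := by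
  induction k generalizing e with
  | zero =>
    constructor
    · rintro rfl
      refine ⟨0, fun _ _ _ => rfl, (attackErr_attackRes_injected_of_le S 0 le_rfl).1, ?_⟩
      intro k' h1 h2; omega
    · rintro ⟨a, -, rfl, -⟩
      exact (attackErr_attackRes_injected_of_le S a le_rfl).1
  | succ k ih =>
    constructor
    · rintro ⟨e₀, he₀, b, hb, rfl, hbn⟩
      obtain ⟨a, hsupp, ha, hbd⟩ := (ih e₀).1 he₀
      have hcongr {k' : ℕ} (hk' : k' ≤ k) :=
        attackErr_attackRes_congr S (s := injected N (Function.update a (k + 1) b))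
          (s' := injected N a) (t := N + k') fun i hi => by
            rw [injected, injected, Function.update_of_ne (by omega)]
      refine ⟨Function.update a (k + 1) b, fun j i hi => ?_, ?_, fun k' h1 h2 => ?_⟩
      · rcases eq_or_ne j (k + 1) with rfl | hj
        · simpa using hb i hi
        · simpa [hj] using hsupp j i hi
      · rw [attackErr_injected_succ, (hcongr le_rfl).1, ha, Function.update_self]
      · rcases Nat.le_succ_iff.1 h2 with h | rfl
        · rw [(hcongr h).2]; exact hbd k' h1 h
        · rw [attackRes_injected_succ, (hcongr le_rfl).1, ha, Function.update_self]
          exact hbn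
    · rintro ⟨a, hsupp, rfl, hbd⟩
      refine ⟨S.attackErr (injected N a) (N + k),
        (ih _).2 ⟨a, hsupp, rfl, fun k' h1 h2 => hbd k' h1 (by omega)⟩, a (k + 1),
        hsupp (k + 1), attackErr_injected_succ S N k a, ?_⟩
      rw [← attackRes_injected_succ]
      exact hbd (k + 1) (by omega) le_rfl

/-- The recursion is linear and the support condition defines a subspace, so scaling only rescales
the residue bound. Boundedness is therefore the same for all positive bounds. -/
theorem smul_mem_reachHat {S : Plant n m p} {Ks : Set (Fin p)} {β c : ℝ} (hc : 0 ≤ c) {k : ℕ}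
    {e : Vec n} (he : e ∈ reachHat S Ks β k) : c • e ∈ reachHat S Ks (c * β) k := by
  induction k generalizing e with
  | zero =>
    rw [show e = 0 from he, smul_zero]
    rfl
  | succ k ih =>
    obtain ⟨e₀, he₀, b, hb, rfl, hbn⟩ := he
    refine ⟨c • e₀, ih he₀, c • b, fun i hi => by simp [hb i hi], ?_, ?_⟩
    · simp only [map_smul, smul_sub]
    · have h : act (S.C * S.A) (c • e₀) = c • act (S.C * S.A) e₀ := map_smul _ _ _
      rw [h, ← smul_add, norm_smul, Real.norm_of_nonneg hc]
      exact mul_le_mul_of_nonneg_left hbn hc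

/-- Boundedness of the reachable sets passes to the deterministic ones, if small residue increments
are stealthy. -/
theorem isBounded_iUnion_reachHat [MeasurableSpace Ω] {μ : Measure Ω} {S : Plant n m p}
    (hS : S.IsSteady) {F : Signals n m p Ω} (hF : F.IsGaussian S μ) {N : ℕ} {D : Detector}
    {Ks : Set (Fin p)} {ε γ α δ : ℝ} (hγ : 0 ≤ γ) (hα : 0 < α) (hδ : 0 < δ) {I : Set ℕ}
    (hstealthy : ∀ k ∈ I, ∀ k', 1 ≤ k' → k' ≤ k → ∀ a : ℕ → Vec p,
      (∀ j, 1 ≤ j → j ≤ k' → ‖S.attackRes (injected N a) (N + j)‖ ≤ δ) →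
      alarm S F μ N D a k' ≤ alarm S F μ N D 0 k' + ε)
    (hb : Bornology.IsBounded (⋃ k ∈ I, reach S F μ N D Ks ε γ k)) :
    Bornology.IsBounded (⋃ k ∈ I, reachHat S Ks α k) := by
  obtain ⟨B, hB⟩ := hb.exists_norm_le
  set e₀ := ∫ x, S.filtErr x ∂S.pathLaw
  refine isBounded_iff_forall_norm_le.2 ⟨α / δ * (B + ‖e₀‖), fun e he => ?_⟩
  obtain ⟨k, hk, hek⟩ := Set.mem_iUnion₂.1 he
  -- Shrinking by `δ / α` lowers the residue bound to `δ`, where the generating attack is stealthy.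
  have h1 := smul_mem_reachHat (div_pos hδ hα).le hek
  rw [div_mul_cancel₀ _ hα.ne', mem_reachHat_iff S Ks δ N] at h1
  obtain ⟨a, hsupp, ha, hres⟩ := h1
  have hmem : a ∈ stealthy S F μ N D Ks ε k :=
    ⟨hsupp, fun k' h1 h2 => hstealthy k hk k' h1 h2 a fun j hj1 hj2 => hres j hj1 (hj2.trans h2)⟩
  have h2 := hB _ (Set.mem_iUnion₂.2 ⟨k, hk, attackErr_mem_reach hS hF hγ hmem⟩)
  rw [ha] at h2
  have h3 : ‖(δ / α) • e‖ ≤ B + ‖e₀‖ := by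
    have := norm_sub_le (e₀ + (δ / α) • e) e₀
    rw [add_sub_cancel_left] at this
    linarith
  rw [norm_smul, Real.norm_of_nonneg (div_pos hδ hα).le] at h3
  calc ‖e‖ = α / δ * (δ / α * ‖e‖) := by field_simp
    _ ≤ _ := mul_le_mul_of_nonneg_left h3 (div_pos hα hδ).le

/-- Boundedness of the deterministic reachable sets passes to the original ones, if stealthy attacks
have bounded residue increments. -/
theorem isBounded_iUnion_reach [MeasurableSpace Ω] {μ : Measure Ω} {S : Plant n m p}
    (hS : S.IsSteady) {F : Signals n m p Ω} (hF : F.IsGaussian S μ) {N : ℕ} {D : Detector}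
    {Ks : Set (Fin p)} {ε γ α M : ℝ} (hα : 0 < α) (hM : 0 < M) {I : Set ℕ}
    (hres : ∀ k ∈ I, ∀ k', 1 ≤ k' → k' ≤ k → ∀ a : ℕ → Vec p,
      alarm S F μ N D a k' ≤ alarm S F μ N D 0 k' + ε →
      ‖S.attackRes (injected N a) (N + k')‖ ≤ M)
    (hb : Bornology.IsBounded (⋃ k ∈ I, reachHat S Ks α k)) :
    Bornology.IsBounded (⋃ k ∈ I, reach S F μ N D Ks ε γ k) := by
  obtain ⟨B, hB⟩ := hb.exists_norm_le
  set e₀ := ∫ x, S.filtErr x ∂S.pathLaw with he₀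
  set P := covMat S.pathLaw S.filtErr
  -- Summing the coordinate bounds gives `‖e₀ + d‖ ^ 2 + γ * P.trace`, and rescaling from `M` to `α`
  -- gives `‖d‖ ≤ M / α * B`.
  refine isBounded_iff_forall_norm_le.2
    ⟨√((‖e₀‖ + M / α * B) ^ 2 + γ * P.trace), fun e he => ?_⟩
  obtain ⟨k, hk, hek⟩ := Set.mem_iUnion₂.1 he
  obtain ⟨a, ha, hsq⟩ := sq_apply_le_of_mem_reach hS hF hek
  rw [← he₀] at hsq
  set d := S.attackErr (injected N a) (N + k)
  have h1 : d ∈ reachHat S Ks M k := (mem_reachHat_iff S Ks M N k d).2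
    ⟨a, ha.1, rfl, fun k' h1 h2 => hres k hk k' h1 h2 a (ha.2 k' h1 h2)⟩
  have h2 := smul_mem_reachHat (div_pos hα hM).le h1
  rw [div_mul_cancel₀ _ hM.ne'] at h2
  have h3 := hB _ (Set.mem_iUnion₂.2 ⟨k, hk, h2⟩)
  rw [norm_smul, Real.norm_of_nonneg (div_pos hα hM).le] at h3
  have h4 : ‖d‖ ≤ M / α * B := by
    calc ‖d‖ = M / α * (α / M * ‖d‖) := by field_simp
      _ ≤ _ := mul_le_mul_of_nonneg_left h3 (div_pos hM hα).le
  refine Real.le_sqrt_of_sq_le ?_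
  have h5 : ‖e‖ ^ 2 ≤ ‖e₀ + d‖ ^ 2 + γ * P.trace := by
    rw [EuclideanSpace.real_norm_sq_eq, EuclideanSpace.real_norm_sq_eq, Matrix.trace,
      Finset.mul_sum, ← Finset.sum_add_distrib]
    exact Finset.sum_le_sum fun i _ => hsq i
  refine h5.trans (add_le_add_left ?_ _)
  exact pow_le_pow_left₀ (norm_nonneg _) ((norm_add_le _ _).trans (by linarith)) 2

end

end

end AttackedKalman

/-! ### The two equivalences: uniform choice of the constants -/

theorem mainTheorem7 {n m p : ℕ} {Ω : Type*} [MeasurableSpace Ω]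
    (μ : MeasureTheory.Measure Ω) [MeasureTheory.IsProbabilityMeasure μ]
    (S : AttackedKalman.Plant n m p) (hS : S.IsSteady)
    (F : AttackedKalman.Signals n m p Ω) (hF : F.IsGaussian S μ)
    (N : ℕ) (D : AttackedKalman.Detector) (hD : D.IsAdmissible N)
    (Ks : Set (Fin p)) (ε γ α : ℝ) (hε : 0 < ε) (hγ : 0 ≤ γ) (hα : 0 < α) :
    (∀ k : ℕ,
      (∀ k', 1 ≤ k' → k' ≤ k → ε < 1 - AttackedKalman.alarm S F μ N D 0 k') →
      (Bornology.IsBounded (AttackedKalman.reach S F μ N D Ks ε γ k) ↔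
        Bornology.IsBounded (AttackedKalman.reachHat S Ks α k))) ∧
    ((∃ τ : ℕ, ∀ k, 1 ≤ k → D.T k = τ) →
      (∀ k, 1 ≤ k → ε < 1 - AttackedKalman.alarm S F μ N D 0 k) →
      (Bornology.IsBounded (⋃ k ∈ Set.Ici 1, AttackedKalman.reach S F μ N D Ks ε γ k) ↔
        Bornology.IsBounded (⋃ k : ℕ, AttackedKalman.reachHat S Ks α k))) := by
  refine ⟨fun k hk => ?_, ?_⟩
  -- Only finitely many times precede a fixed `k`, so one `δ` and one `M` serve them all, even with
  -- varying windows.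
  · have hsmall : ∀ᶠ δ in nhdsWithin (0 : ℝ) (Set.Ioi 0), ∀ k' ∈ Finset.Icc 1 k,
        ∀ a : ℕ → AttackedKalman.Vec p,
        (∀ j, 1 ≤ j → j ≤ k' → ‖S.attackRes (AttackedKalman.injected N a) (N + j)‖ ≤ δ) →
        AttackedKalman.alarm S F μ N D a k' ≤ AttackedKalman.alarm S F μ N D 0 k' + ε := by
      refine (Filter.eventually_all_finset _).2 fun k' hk' => ?_
      have h1 := (Finset.mem_Icc.1 hk').1
      filter_upwards [AttackedKalman.eventually_alarm_le hS hF hD hε ⟨k', h1, rfl⟩] with δ hδ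
      exact hδ k' h1 rfl
    have hlarge : ∀ᶠ M in Filter.atTop, ∀ k' ∈ Finset.Icc 1 k,
        ∀ a : ℕ → AttackedKalman.Vec p,
        AttackedKalman.alarm S F μ N D a k' ≤ AttackedKalman.alarm S F μ N D 0 k' + ε →
        ‖S.attackRes (AttackedKalman.injected N a) (N + k')‖ ≤ M := by
      refine (Filter.eventually_all_finset _).2 fun k' hk' => ?_
      obtain ⟨h1, h2⟩ := Finset.mem_Icc.1 hk'
      filter_upwards [AttackedKalman.eventually_norm_attackRes_le hS hF hD
        ⟨k', h1, rfl, hk k' h1 h2⟩] with M hM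
      exact hM k' h1 rfl
    obtain ⟨δ, hδ, hδ0⟩ := (hsmall.and self_mem_nhdsWithin).exists
    obtain ⟨M, hM, hM0⟩ := (hlarge.and (Filter.eventually_gt_atTop 0)).exists
    have h1 := AttackedKalman.isBounded_iUnion_reachHat (Ks := Ks) (I := {k}) hS hF hγ hα hδ0
      (fun l hl k' h1 h2 => hδ k' (Finset.mem_Icc.2 ⟨h1, h2.trans_eq hl⟩))
    have h2 := AttackedKalman.isBounded_iUnion_reach (Ks := Ks) (γ := γ) (I := {k}) hS hF hα hM0
      (fun l hl k' h1 h2 => hM k' (Finset.mem_Icc.2 ⟨h1, h2.trans_eq hl⟩))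
    simp only [Set.biUnion_singleton] at h1 h2
    exact ⟨h1, h2⟩
  · rintro ⟨τ, hτ⟩ hk
    -- With a constant window the constants found for time `1` are valid at all times.
    obtain ⟨δ, hδ, hδ0⟩ := ((AttackedKalman.eventually_alarm_le hS hF hD hε
      ⟨1, le_rfl, hτ 1 le_rfl⟩).and self_mem_nhdsWithin).exists
    obtain ⟨M, hM, hM0⟩ := ((AttackedKalman.eventually_norm_attackRes_le hS hF hD
      ⟨1, le_rfl, hτ 1 le_rfl, hk 1 le_rfl⟩).and (Filter.eventually_gt_atTop 0)).exists
    have h1 := AttackedKalman.isBounded_iUnion_reachHat (Ks := Ks) (I := Set.Ici 1) hS hF hγ hα hδ0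
      (fun _ _ k' h1 _ => hδ k' h1 (hτ k' h1))
    have h2 := AttackedKalman.isBounded_iUnion_reach (Ks := Ks) (γ := γ) (I := Set.Ici 1) hS hF hα hM0
      (fun _ _ k' h1 _ => hM k' h1 (hτ k' h1))
    refine ⟨fun h => ?_, fun h => h2 (h.subset (Set.iUnion₂_subset_iUnion _ _))⟩
    -- The index `0` occurs only in the deterministic union, where it contributes just the origin.
    refine ((h1 h).union (Bornology.isBounded_singleton (x := 0))).subset
      (Set.iUnion_subset fun k => ?_)
    rcases Nat.eq_zero_or_pos k with rfl | hkpos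
    · exact Set.subset_union_right
    · exact (Set.subset_biUnion_of_mem (u := fun k => AttackedKalman.reachHat S Ks α k)
        (Set.mem_Ici.2 hkpos)).trans Set.subset_union_left
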